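/- For $n\ge 0$ let $p=(p_0,\dots,p_n)$ and $q=(q_0,\dots,q_n)$ be sequences of points of $\mathbb R^2$. Let $P,Q\colon[0,n]\to\mathbb R^2$ be the polygonal curves with these vertices, that is, $P(i+\lambda)=(1-\lambda)p_i+\lambda p_{i+1}$ for $0\le i<n$ and $\lambda\in[0,1]$ (for $n=0$, $P(0)=p_0$), and similarly for $Q$. Their Fréchet distance is \[ d_F(P,Q)=\inf_{\sigma}\ \max_{x\in[0,n]}\|P(x)-Q(\sigma(x))\|, \] where $\|\cdot\|$ is the Euclidean norm and $\sigma$ ranges over all continuous nondecreasing functions $[0,n]\to[0,n]$ with $\sigma(0)=0$ and $\sigma(n)=n$. An algebraic decision tree with real inputs $x_1,\dots,x_N$ is a finite rooted tree with three kinds of nodes. A computation node $v$ has one child and computes $y_v=y_u\oplus y_w$ with $\oplus\in\{+,-,\cdot,/\}$, or $y_v=\sqrt{y_u}$, where each of $y_u,y_w$ is an input variable or the value computed at a computation node that is a proper ancestor of $v$. A branch node has two children and tests $y_u=0$ or $y_u>0$, where $y_u$ is an input variable or a value computed at an ancestor. A leaf is labelled "accept" or "reject". Every input determines a path from the root; division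 by $0$ and the square root of a negative number are undefined. The depth of the tree is the largest number of computation and branch nodes on a path from the root to a leaf. **Theorem.** There are a constant $\varepsilon>0$ and, for every $n$, an algebraic decision tree $T_n$ whose $4(n+1)$ inputs are the coordinates of $p_0,\dots,p_n,q_0,\dots,q_n$, such that the depth of $T_n$ is $O(n^{2-\varepsilon})$ and such that, for all $p$ and $q$, the computation of $T_n$ on $(p,q)$ meets no undefined operation and ends in an accepting leaf if $d_F(P,Q)\le 1$ and in a rejecting leaf if $d_F(P,Q)>1$. -/

import Mathlib

open Set Filter Asymptotics

noncomputable section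

/-- The Euclidean plane. -/
abbrev Plane : Type := EuclideanSpace ℝ (Fin 2)

/-- The polygonal curve with vertices `p 0, …, p n`, as a function of a parameter in `[0, n]`:
at `i + s` with `i < n` and `0 ≤ s ≤ 1` its value is `(1 - s) • p i + s • p (i + 1)`.
(The values outside `[0, n]` are irrelevant; the minimum only keeps the indices in range.) -/
def polyCurve {n : ℕ} (p : Fin (n + 1) → Plane) (t : ℝ) : Plane :=
  (1 - Int.fract t) • p ⟨min ⌊t⌋₊ n, Nat.lt_succ_of_le (min_le_right _ _)⟩ +
    Int.fract t • p ⟨min (⌊t⌋₊ + 1) n, Nat.lt_succ_of_le (min_le_right _ _)⟩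

/-- `σ` restricts to a continuous nondecreasing function `[0, n] → [0, n]` with `σ 0 = 0` and
`σ n = n`. -/
def IsReparam (n : ℕ) (σ : ℝ → ℝ) : Prop :=
  ContinuousOn σ (Icc (0 : ℝ) n) ∧ MonotoneOn σ (Icc (0 : ℝ) n) ∧ σ 0 = 0 ∧ σ n = n

/-- The Fréchet distance of the polygonal curves with vertex sequences `p` and `q`: the infimum,
over all reparametrizations `σ`, of `max_{x ∈ [0, n]} ‖P x - Q (σ x)‖`. -/
def frechetDist {n : ℕ} (p q : Fin (n + 1) → Plane) : ℝ :=
  sInf {r : ℝ | ∃ σ : ℝ → ℝ, IsReparam n σ ∧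
    IsGreatest ((fun x : ℝ => ‖polyCurve p x - polyCurve q (σ x)‖) '' Icc (0 : ℝ) n) r}

/-- An operand available at a node of a tree with inputs indexed by `ι`, when there are `k`
computation nodes above that node: an input variable or the result of one of these. -/
abbrev Operand (ι : Type) (k : ℕ) : Type := ι ⊕ Fin k

/-- The right-hand side of a computation node. -/
inductive AlgExpr (ι : Type) (k : ℕ) : Type
  | add (u w : Operand ι k)
  | sub (u w : Operand ι k)
  | mul (u w : Operand ι k)
  | div (u w : Operand ι k)
  | sqrt (u : Operand ι k)

/-- The condition tested at a branch node: `y = 0` or `y > 0`. -/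
inductive AlgTest (ι : Type) (k : ℕ) : Type
  | eqZero (u : Operand ι k)
  | pos (u : Operand ι k)

/-- Algebraic (sub)trees with inputs indexed by `ι` and `k` computation nodes above the root;
a whole tree is a term of `AlgTree ι 0`. A computation node has one child, in which its result is
available as the new operand with the number `k`. A branch node has two children, the first one
for the case that the test succeeds. A leaf carries the answer (accept or reject). -/
inductive AlgTree (ι : Type) : ℕ → Type
  | leaf {k : ℕ} (answer : Bool) : AlgTree ι k
  | comp {k : ℕ} (e : AlgExpr ι k) (child : AlgTree ι (k + 1)) : AlgTree ι k
  | branch {k : ℕ} (c : AlgTest ι k) (yes no : AlgTree ι k) : AlgTree ι k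

namespace Operand

/-- The value of an operand, for the inputs `x` and the results `y` computed so far. -/
def val {ι : Type} {k : ℕ} (x : ι → ℝ) (y : Fin k → ℝ) (u : Operand ι k) : ℝ :=
  Sum.elim x y u

end Operand

namespace AlgExpr

open scoped Classical in
/-- The value of an expression; division by zero and the square root of a negative number are
undefined. -/
def eval {ι : Type} {k : ℕ} (x : ι → ℝ) (y : Fin k → ℝ) : AlgExpr ι k → Option ℝ
  | add u w => some (Operand.val x y u + Operand.val x y w)
  | sub u w => some (Operand.val x y u - Operand.val x y w)
  | mul u w => some (Operand.val x y u * Operand.val x y w)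
  | div u w => if Operand.val x y w = 0 then none
      else some (Operand.val x y u / Operand.val x y w)
  | sqrt u => if Operand.val x y u < 0 then none else some (Real.sqrt (Operand.val x y u))

end AlgExpr

namespace AlgTest

/-- The test succeeds. -/
def Holds {ι : Type} {k : ℕ} (x : ι → ℝ) (y : Fin k → ℝ) : AlgTest ι k → Prop
  | eqZero u => Operand.val x y u = 0
  | pos u => 0 < Operand.val x y u

end AlgTest

namespace AlgTree

/-- The depth: the largest number of computation nodes and branch nodes on a path from the root to
a leaf. -/
def depth {ι : Type} : {k : ℕ} → AlgTree ι k → ℕ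
  | _, leaf _ => 0
  | _, comp _ child => child.depth + 1
  | _, branch _ yes no => max yes.depth no.depth + 1

open scoped Classical in
/-- The answer of the tree on the inputs `x`, when the computation nodes above the root have
produced the results `y`; it is `none` if an undefined operation is met on the way. -/
def eval {ι : Type} (x : ι → ℝ) : {k : ℕ} → AlgTree ι k → (Fin k → ℝ) → Option Bool
  | _, leaf answer, _ => some answer
  | k, comp e child, y =>
      (e.eval x y).bind fun r => child.eval x (Fin.snoc (n := k) (α := fun _ => ℝ) y r)
  | _, branch c yes no, y => if c.Holds x y then yes.eval x y else no.eval x y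

/-- The answer of a whole tree on the inputs `x`. -/
def run {ι : Type} (T : AlgTree ι 0) (x : ι → ℝ) : Option Bool :=
  T.eval x Fin.elim0

end AlgTree

/-- Names of the `4 (n + 1)` real inputs: the coordinates of the vertices of the first curve
(`Sum.inl`) and of the second curve (`Sum.inr`). -/
abbrev CurveVar (n : ℕ) : Type := (Fin (n + 1) ⊕ Fin (n + 1)) × Fin 2

/-- The input vector that encodes a pair of polygonal curves. -/
def curveInput {n : ℕ} (p q : Fin (n + 1) → Plane) : CurveVar n → ℝ :=
  fun v => Sum.elim p q v.1 v.2

end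

/-! The distance is at most one iff a monotone path inside the free space, the set of `(x, y)` with
`‖P x - Q y‖ ≤ 1`, joins the two corners of the parameter square. In each unit cell the free space
is convex, so the reachable part of a cell side is an interval that ends where the free interval of
that side ends, and only its start must be propagated. The rule `gridStep` merely compares and
copies: along a row or column of cells, every start is either the empty mark `2`, or the first start
on that line, or the lower end of a free interval of that line.

This allows a saving by blocks of `τ × τ` cells. Suppose the order of the free ends on every line of
the block is known. Once the `2τ` starts that enter the block are located in these orders by binary
search, every comparison inside the block is decided (`statusIn_block`). A decision tree pays for
operations and tests but not for bookkeeping, so a block costs `τ log τ` instead of `τ²`.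

It remains to sort the free ends of `τ` vertices on one segment in `O(log τ)` steps, after
preprocessing the vertices. The ends contain square roots, but the sign of the difference of two of
them depends only on the signs of finitely many fixed polynomials (`SignDet.freeEnd_sub_freeEnd`). A
polynomial in the coordinates of the vertices and of the segment is a bilinear form in polynomials
of each group (`IsPolyFun.exists_bilinear`); for given vertices it is a linear form, evaluated at a
vector that depends on the segment only. The task is thus point location among hyperplanes in a
fixed dimension, with polynomial preprocessing and logarithmic queries (`KState.exists_can_locate`).
With `m` about `n / τ` the total is of order `n + m τ^e + m² τ log τ`, which is subquadratic for `τ`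
about `n ^ (1 / (e + 2))`.

Correctness of the recursion is `frechetDist_le_one_iff`. A monotone path may have vertical pieces
and is then not the graph of a reparametrization, so it is tilted by an arbitrarily small amount
(`frechetDist_le_one_of_path`). Conversely the infimum may not be attained, so a limit is taken of
the crossings with the grid lines only, which form a compact space (`exists_isCrossing_one`).

Trees are handled semantically: a node is the set of functions computed so far together with the set
of inputs that reach it, and anything constant on these inputs is known for free.
`KState.Reach.exists_tree` turns such an argument into a tree. -/

/-! ### Decision trees described by available functions and surviving inputs -/

/-- The situation at a node of a decision tree whose inputs are the points of `X`: the functions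
whose values are available there, and the inputs that lead to the node. -/
structure KState (X : Type*) where
  /-- the available functions -/
  vals : Set (X → ℝ)
  /-- the inputs that lead to the node -/
  dom : Set X

namespace KState

variable {X : Type*}

instance : Preorder (KState X) where
  le s t := s.vals ⊆ t.vals ∧ t.dom ⊆ s.dom
  le_refl _ := ⟨Subset.rfl, Subset.rfl⟩
  le_trans _ _ _ h h' := ⟨h.1.trans h'.1, h'.2.trans h.2⟩

/-- The value of `f` is available. -/
def Known (f : X → ℝ) (s : KState X) : Prop := ∃ g ∈ s.vals, EqOn f g s.dom

/-- The sign of `f` is the same for all inputs that lead to the node. -/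
def SignKnown (f : X → ℝ) (s : KState X) : Prop :=
  ∃ σ : SignType, ∀ x ∈ s.dom, SignType.sign (f x) = σ

theorem monotone_known (f : X → ℝ) : Monotone (Known f) := by
  rintro s t h ⟨g, hg, hfg⟩
  exact ⟨g, h.1 hg, hfg.mono h.2⟩

theorem monotone_signKnown (f : X → ℝ) : Monotone (SignKnown f) := by
  rintro s t h ⟨σ, hσ⟩
  exact ⟨σ, fun x hx => hσ x (h.2 hx)⟩

theorem Known.congr {f g : X → ℝ} {s : KState X} (h : Known f s) (hfg : EqOn g f s.dom) :
    Known g s := by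
  obtain ⟨k, hk, hfk⟩ := h
  exact ⟨k, hk, hfg.trans hfk⟩

theorem SignKnown.congr {f g : X → ℝ} {s : KState X} (h : SignKnown f s)
    (hfg : EqOn g f s.dom) : SignKnown g s := by
  obtain ⟨σ, hσ⟩ := h
  exact ⟨σ, fun x hx => by rw [hfg hx, hσ x hx]⟩

/-- A function with a constant sign pattern has a known sign. -/
theorem signKnown_of_forall {f : X → ℝ} {s : KState X}
    (h : ∀ x ∈ s.dom, ∀ y ∈ s.dom, SignType.sign (f x) = SignType.sign (f y)) :
    SignKnown f s := by
  rcases s.dom.eq_empty_or_nonempty with he | ⟨y, hy⟩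
  · exact ⟨0, fun x hx => by simp [he] at hx⟩
  · exact ⟨_, fun x hx => h x hx y hy⟩

theorem SignKnown.sign_eq {f : X → ℝ} {s : KState X} (h : SignKnown f s) {x y : X}
    (hx : x ∈ s.dom) (hy : y ∈ s.dom) : SignType.sign (f x) = SignType.sign (f y) := by
  obtain ⟨σ, hσ⟩ := h
  rw [hσ x hx, hσ y hy]

/-- `f` arises from available functions by one operation that is defined for all inputs that lead
to the node. -/
inductive OneOp (s : KState X) : (X → ℝ) → Prop
  | add {u w : X → ℝ} : Known u s → Known w s → OneOp s fun x => u x + w x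
  | sub {u w : X → ℝ} : Known u s → Known w s → OneOp s fun x => u x - w x
  | mul {u w : X → ℝ} : Known u s → Known w s → OneOp s fun x => u x * w x
  | div {u w : X → ℝ} : Known u s → Known w s → (∀ x ∈ s.dom, w x ≠ 0) →
      OneOp s fun x => u x / w x
  | sqrt {u : X → ℝ} : Known u s → (∀ x ∈ s.dom, 0 ≤ u x) → OneOp s fun x => √(u x)

/-- Some tree of depth at most `d`, started in the given situation, only ends in situations that
satisfy `P`. -/
inductive Reach (P : KState X → Prop) : ℕ → KState X → Prop
  | done {d : ℕ} {s : KState X} : P s → Reach P d s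
  | comp {d : ℕ} {s : KState X} {f : X → ℝ} : OneOp s f →
      Reach P d ⟨insert f s.vals, s.dom⟩ → Reach P (d + 1) s
  | eqZero {d : ℕ} {s : KState X} {u : X → ℝ} : Known u s →
      Reach P d ⟨s.vals, s.dom ∩ {x | u x = 0}⟩ →
      Reach P d ⟨s.vals, s.dom ∩ {x | ¬ u x = 0}⟩ → Reach P (d + 1) s
  | pos {d : ℕ} {s : KState X} {u : X → ℝ} : Known u s →
      Reach P d ⟨s.vals, s.dom ∩ {x | 0 < u x}⟩ →
      Reach P d ⟨s.vals, s.dom ∩ {x | ¬ 0 < u x}⟩ → Reach P (d + 1) s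

theorem le_insert (s : KState X) (f : X → ℝ) : s ≤ ⟨insert f s.vals, s.dom⟩ :=
  ⟨subset_insert _ _, Subset.rfl⟩

theorem le_inter (s : KState X) (A : Set X) : s ≤ ⟨s.vals, s.dom ∩ A⟩ :=
  ⟨Subset.rfl, inter_subset_left⟩

theorem Reach.mono_depth {P : KState X → Prop} {d e : ℕ} {s : KState X} (h : Reach P d s)
    (hde : d ≤ e) : Reach P e s := by
  induction h generalizing e with
  | done h => exact .done h
  | comp ho _ ih =>
    obtain ⟨e, rfl⟩ := Nat.exists_eq_add_of_le' (Nat.one_le_of_lt hde)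
    exact .comp ho (ih (by omega))
  | eqZero hu _ _ ih ih' =>
    obtain ⟨e, rfl⟩ := Nat.exists_eq_add_of_le' (Nat.one_le_of_lt hde)
    exact .eqZero hu (ih (by omega)) (ih' (by omega))
  | pos hu _ _ ih ih' =>
    obtain ⟨e, rfl⟩ := Nat.exists_eq_add_of_le' (Nat.one_le_of_lt hde)
    exact .pos hu (ih (by omega)) (ih' (by omega))

/-- A second tree is grafted at every leaf of the first, so depths add. The continuation may depend
on the leaf, where at least as much is known as at the root. -/
theorem Reach.bind {P Q : KState X → Prop} {d e : ℕ} {s : KState X} (h : Reach P d s)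
    (hQ : ∀ t, s ≤ t → P t → Reach Q e t) : Reach Q (d + e) s := by
  induction h with
  | done h => exact (hQ _ le_rfl h).mono_depth (by omega)
  | comp ho _ ih =>
    rw [Nat.add_right_comm]
    exact .comp ho (ih fun t ht => hQ t ((le_insert _ _).trans ht))
  | eqZero hu _ _ ih ih' =>
    rw [Nat.add_right_comm]
    exact .eqZero hu (ih fun t ht => hQ t ((le_inter _ _).trans ht))
      (ih' fun t ht => hQ t ((le_inter _ _).trans ht))
  | pos hu _ _ ih ih' =>
    rw [Nat.add_right_comm]
    exact .pos hu (ih fun t ht => hQ t ((le_inter _ _).trans ht))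
      (ih' fun t ht => hQ t ((le_inter _ _).trans ht))

/-- From `s`, and whatever is known in addition, a tree of depth at most `d` achieves `P`. -/
def Can (s : KState X) (d : ℕ) (P : KState X → Prop) : Prop := ∀ t, s ≤ t → Reach P d t

theorem monotone_can (d : ℕ) (P : KState X → Prop) : Monotone fun s : KState X => Can s d P :=
  fun _ _ h hs u hu => hs u (h.trans hu)

theorem Can.mono {s t : KState X} {d : ℕ} {P : KState X → Prop} (h : Can s d P) (hst : s ≤ t) :
    Can t d P := monotone_can d P hst h

theorem Can.mono_depth {s : KState X} {d e : ℕ} {P : KState X → Prop} (h : Can s d P)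
    (hde : d ≤ e) : Can s e P := fun t ht => (h t ht).mono_depth hde

theorem can_of_monotone {s : KState X} {P : KState X → Prop} (hP : Monotone P) (h : P s) (d : ℕ) :
    Can s d P := fun _ ht => .done (hP ht h)

theorem Can.bind {s : KState X} {d e : ℕ} {P Q : KState X → Prop} (h : Can s d P)
    (hQ : ∀ t, s ≤ t → P t → Can t e Q) : Can s (d + e) Q :=
  fun t ht => (h t ht).bind fun u hu hP => hQ u (ht.trans hu) hP u le_rfl

theorem Can.imp {s : KState X} {d : ℕ} {P Q : KState X → Prop} (h : Can s d P)
    (hQ : ∀ t, s ≤ t → P t → Q t) : Can s d Q :=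
  fun t ht => (h t ht).bind (e := 0) fun u hu hP => .done (hQ u (ht.trans hu) hP)

theorem Can.and {s : KState X} {d e : ℕ} {P Q : KState X → Prop} (hP : Monotone P)
    (h : Can s d P) (h' : Can s e Q) : Can s (d + e) fun t => P t ∧ Q t :=
  h.bind fun _ ht hPt => (h'.mono ht).imp fun _ hu hQu => ⟨hP hu hPt, hQu⟩

/-- The goals are achieved one after another; monotonicity keeps those already achieved. -/
theorem can_forall_finset {α : Type*} {s : KState X} {d : ℕ} {P : α → KState X → Prop}
    (F : Finset α) (hP : ∀ a ∈ F, Monotone (P a)) (h : ∀ a ∈ F, Can s d (P a)) :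
    Can s (F.card * d) fun t => ∀ a ∈ F, P a t := by
  classical
  induction F using Finset.induction_on with
  | empty => exact fun t _ => .done (by simp)
  | insert a F ha ih =>
    rw [Finset.card_insert_of_notMem ha, add_mul, one_mul]
    refine ((ih (fun b hb => hP b (by simp [hb])) fun b hb => h b (by simp [hb])).and ?_
      (h a (by simp))).imp ?_
    · intro s t hst hs b hb
      exact hP b (by simp [hb]) hst (hs b hb)
    · rintro t - ⟨h1, h2⟩ b hb
      rcases Finset.mem_insert.1 hb with rfl | hb
      · exact h2
      · exact h1 b hb

theorem can_forall {α : Type*} [Fintype α] {s : KState X} {d : ℕ} {P : α → KState X → Prop}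
    (hP : ∀ a, Monotone (P a)) (h : ∀ a, Can s d (P a)) :
    Can s (Fintype.card α * d) fun t => ∀ a, P a t :=
  (can_forall_finset Finset.univ (fun a _ => hP a) fun a _ => h a).imp
    fun _ _ h a => h a (Finset.mem_univ a)

theorem can_iterate {s : KState X} {d : ℕ} {P : ℕ → KState X → Prop} (N : ℕ)
    (h0 : Can s 0 (P 0)) (h : ∀ k < N, ∀ t, s ≤ t → P k t → Can t d (P (k + 1))) :
    Can s (N * d) (P N) := by
  induction N with
  | zero => exact h0.mono_depth (by omega)
  | succ N ih =>
    rw [add_mul, one_mul]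
    exact (ih fun k hk => h k (by omega)).bind (h N (by omega))

theorem OneOp.reach {s : KState X} {f : X → ℝ} (h : OneOp s f) : Reach (Known f) 1 s :=
  .comp h (.done ⟨f, mem_insert _ _, fun _ _ => rfl⟩)

section Computation

variable {s : KState X} {u w : X → ℝ} {d e : ℕ}

theorem can_of_known (h : Known u s) (d : ℕ) : Can s d (Known u) :=
  can_of_monotone (monotone_known u) h d

theorem Can.add (hu : Can s d (Known u)) (hw : Can s e (Known w)) :
    Can s (d + e + 1) (Known fun x => u x + w x) :=
  (hu.and (monotone_known u) hw).bind fun _ _ h _ hv => (OneOp.add (monotone_known _ hv h.1)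
    (monotone_known _ hv h.2)).reach

theorem Can.sub (hu : Can s d (Known u)) (hw : Can s e (Known w)) :
    Can s (d + e + 1) (Known fun x => u x - w x) :=
  (hu.and (monotone_known u) hw).bind fun _ _ h _ hv => (OneOp.sub (monotone_known _ hv h.1)
    (monotone_known _ hv h.2)).reach

theorem Can.mul (hu : Can s d (Known u)) (hw : Can s e (Known w)) :
    Can s (d + e + 1) (Known fun x => u x * w x) :=
  (hu.and (monotone_known u) hw).bind fun _ _ h _ hv => (OneOp.mul (monotone_known _ hv h.1)
    (monotone_known _ hv h.2)).reach

theorem Can.div (hu : Can s d (Known u)) (hw : Can s e (Known w)) (h0 : ∀ x ∈ s.dom, w x ≠ 0) :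
    Can s (d + e + 1) (Known fun x => u x / w x) :=
  (hu.and (monotone_known u) hw).bind fun _ ht h _ hv => (OneOp.div (monotone_known _ hv h.1)
    (monotone_known _ hv h.2) fun x hx => h0 x ((ht.trans hv).2 hx)).reach

theorem Can.sqrt (hu : Can s d (Known u)) (h0 : ∀ x ∈ s.dom, 0 ≤ u x) :
    Can s (d + 1) (Known fun x => √(u x)) :=
  hu.bind fun _ ht h _ hv => (OneOp.sqrt (monotone_known _ hv h)
    fun x hx => h0 x ((ht.trans hv).2 hx)).reach

theorem Can.sign (hu : Can s d (Known u)) : Can s (d + 2) (SignKnown u) := by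
  refine hu.bind fun t _ ht v hv => ?_
  have ht := monotone_known _ hv ht
  refine .eqZero ht (.done ⟨0, fun x hx => ?_⟩)
    (.pos (monotone_known _ (le_inter _ _) ht) (.done ⟨1, fun x hx => ?_⟩)
      (.done ⟨-1, fun x hx => ?_⟩))
  · exact sign_eq_zero_iff.2 hx.2
  · exact sign_eq_one_iff.2 hx.2
  · exact sign_eq_neg_one_iff.2 (lt_of_le_of_ne (not_lt.1 hx.2) hx.1.2)

theorem Can.congr_known (hu : Can s d (Known u)) (h : EqOn w u s.dom) : Can s d (Known w) :=
  hu.imp fun _ ht hk => hk.congr (h.mono ht.2)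

theorem can_sum {m : ℕ} {f : Fin m → X → ℝ} (h0 : Known 0 s)
    (h : ∀ i, Can s d (Known (f i))) :
    Can s (m * (d + 1)) (Known fun x => ∑ i, f i x) := by
  induction m with
  | zero => exact (can_of_known h0 _).congr_known fun x _ => by simp
  | succ m ih =>
    refine (((ih (f := fun i => f i.castSucc) fun i => h _).add (h (Fin.last m))).mono_depth
      (by ring_nf; omega)).congr_known fun x _ => by simp [Fin.sum_univ_castSucc]

end Computation

/-- Translation of `Reach` into an actual tree. -/
theorem Reach.exists_tree {ι : Type} {ans : (ι → ℝ) → Bool} {d : ℕ} {s : KState (ι → ℝ)}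
    (h : Reach (fun s => ∃ b, ∀ x ∈ s.dom, ans x = b) d s) :
    ∀ {k : ℕ} (y : (ι → ℝ) → Fin k → ℝ),
      (∀ f ∈ s.vals, ∃ u : Operand ι k, ∀ x ∈ s.dom, u.val x (y x) = f x) →
      ∃ T : AlgTree ι k, T.depth ≤ d ∧ ∀ x ∈ s.dom, T.eval x (y x) = some (ans x) := by
  induction h with
  | done h =>
    intro k y hy
    obtain ⟨b, hb⟩ := h
    exact ⟨.leaf b, by simp [AlgTree.depth], fun x hx => by simp [AlgTree.eval, hb x hx]⟩
  | @comp d s f ho _ ih =>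
    intro k y hy
    have key : ∃ e : AlgExpr ι k, ∀ x ∈ s.dom, e.eval x (y x) = some (f x) := by
      have hk : ∀ {u : (ι → ℝ) → ℝ}, Known u s →
          ∃ o : Operand ι k, ∀ x ∈ s.dom, o.val x (y x) = u x := by
        rintro u ⟨g, hg, hug⟩
        obtain ⟨o, ho⟩ := hy g hg
        exact ⟨o, fun x hx => by rw [ho x hx, hug hx]⟩
      cases ho with
      | add hu hw =>
        obtain ⟨o, ho⟩ := hk hu
        obtain ⟨o', ho'⟩ := hk hw
        exact ⟨.add o o', fun x hx => by simp [AlgExpr.eval, ho x hx, ho' x hx]⟩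
      | sub hu hw =>
        obtain ⟨o, ho⟩ := hk hu
        obtain ⟨o', ho'⟩ := hk hw
        exact ⟨.sub o o', fun x hx => by simp [AlgExpr.eval, ho x hx, ho' x hx]⟩
      | mul hu hw =>
        obtain ⟨o, ho⟩ := hk hu
        obtain ⟨o', ho'⟩ := hk hw
        exact ⟨.mul o o', fun x hx => by simp [AlgExpr.eval, ho x hx, ho' x hx]⟩
      | div hu hw h0 =>
        obtain ⟨o, ho⟩ := hk hu
        obtain ⟨o', ho'⟩ := hk hw
        exact ⟨.div o o', fun x hx => by simp [AlgExpr.eval, ho x hx, ho' x hx, h0 x hx]⟩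
      | sqrt hu h0 =>
        obtain ⟨o, ho⟩ := hk hu
        exact ⟨.sqrt o, fun x hx => by simp [AlgExpr.eval, ho x hx, h0 x hx]⟩
    obtain ⟨e, he⟩ := key
    -- The new result becomes the last operand, and the older operands are shifted along
    -- `Fin.castSucc`.
    obtain ⟨T, hT, hev⟩ := ih (fun x => Fin.snoc (n := k) (α := fun _ => ℝ) (y x) (f x)) (by
      rintro g (rfl | hg)
      · exact ⟨.inr (Fin.last k), fun x _ => by simp [Operand.val]⟩
      · obtain ⟨o, ho⟩ := hy g hg
        refine ⟨o.map id Fin.castSucc, fun x hx => ?_⟩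
        rw [← ho x hx]
        cases o <;> simp [Operand.val])
    exact ⟨.comp e T, by simpa [AlgTree.depth] using hT,
      fun x hx => by simpa [AlgTree.eval, he x hx] using hev x hx⟩
  | @eqZero d s u hu _ _ ih ih' =>
    intro k y hy
    obtain ⟨g, hg, hug⟩ := hu
    obtain ⟨o, ho⟩ := hy g hg
    obtain ⟨T, hT, hev⟩ := ih y fun g hg => (hy g hg).imp fun o ho x hx => ho x hx.1
    obtain ⟨T', hT', hev'⟩ := ih' y fun g hg => (hy g hg).imp fun o ho x hx => ho x hx.1
    refine ⟨.branch (.eqZero o) T T', by simp [AlgTree.depth, hT, hT'], fun x hx => ?_⟩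
    by_cases h0 : u x = 0
    · simpa [AlgTree.eval, AlgTest.Holds, ho x hx, ← hug hx, h0] using hev x ⟨hx, h0⟩
    · simpa [AlgTree.eval, AlgTest.Holds, ho x hx, ← hug hx, h0] using hev' x ⟨hx, h0⟩
  | @pos d s u hu _ _ ih ih' =>
    intro k y hy
    obtain ⟨g, hg, hug⟩ := hu
    obtain ⟨o, ho⟩ := hy g hg
    obtain ⟨T, hT, hev⟩ := ih y fun g hg => (hy g hg).imp fun o ho x hx => ho x hx.1
    obtain ⟨T', hT', hev'⟩ := ih' y fun g hg => (hy g hg).imp fun o ho x hx => ho x hx.1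
    refine ⟨.branch (.pos o) T T', by simp [AlgTree.depth, hT, hT'], fun x hx => ?_⟩
    by_cases h0 : 0 < u x
    · simpa only [AlgTree.eval, AlgTest.Holds, ho x hx, ← hug hx, h0, if_true] using
        hev x ⟨hx, h0⟩
    · simpa only [AlgTree.eval, AlgTest.Holds, ho x hx, ← hug hx, h0, if_false] using
        hev' x ⟨hx, h0⟩

end KState

/-! ### Medians and binary search -/

/-- Take `m` of largest value among the elements with at most half of the set strictly below. If
more than half lay above `m`, the next larger value would also have at most half below it. -/
theorem Finset.exists_median {α : Type*} (F : Finset α) (hF : F.Nonempty) (v : α → ℝ) :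
    ∃ m ∈ F, 2 * (F.filter fun a => v a < v m).card ≤ F.card ∧
      2 * (F.filter fun a => v m < v a).card ≤ F.card := by
  classical
  obtain ⟨m₀, hm₀, hmin⟩ := F.exists_min_image v hF
  have hne : (F.filter fun m => 2 * (F.filter fun a => v a < v m).card ≤ F.card).Nonempty := by
    refine ⟨m₀, Finset.mem_filter.2 ⟨hm₀, ?_⟩⟩
    rw [Finset.filter_false_of_mem fun a ha => not_lt.2 (hmin a ha)]
    simp
  obtain ⟨m, hm, hmax⟩ := Finset.exists_max_image _ v hne
  rw [Finset.mem_filter] at hm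
  refine ⟨m, hm.1, hm.2, ?_⟩
  by_contra! hlt
  obtain ⟨k, hk, hkmin⟩ := (F.filter fun a => v m < v a).exists_min_image v
    (Finset.card_pos.1 (by omega))
  rw [Finset.mem_filter] at hk
  have hdisj : Disjoint (F.filter fun a => v a < v k) (F.filter fun a => v m < v a) := by
    rw [Finset.disjoint_left]
    intro a ha ha'
    exact absurd (Finset.mem_filter.1 ha).2 (not_lt.2 (hkmin a ha'))
  have hcard := Finset.card_le_card (Finset.union_subset
    (Finset.filter_subset (fun a => v a < v k) F) (Finset.filter_subset (fun a => v m < v a) F))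
  rw [Finset.card_union_of_disjoint hdisj] at hcard
  exact absurd (hmax k (Finset.mem_filter.2 ⟨hk.1, by omega⟩)) (not_le.2 hk.2)

namespace KState

variable {X : Type*}

theorem SignKnown.neg {f : X → ℝ} {s : KState X} (h : SignKnown f s) :
    SignKnown (fun x => -f x) s := by
  obtain ⟨σ, hσ⟩ := h
  exact ⟨-σ, fun x hx => by rw [Left.sign_neg, hσ x hx]⟩

theorem SignKnown.mul {f g : X → ℝ} {s : KState X} (hf : SignKnown f s) (hg : SignKnown g s) :
    SignKnown (fun x => f x * g x) s := by
  obtain ⟨σ, hσ⟩ := hf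
  obtain ⟨τ, hτ⟩ := hg
  exact ⟨σ * τ, fun x hx => by rw [sign_mul, hσ x hx, hτ x hx]⟩

/-- Each round computes the median member (`c`), subtracts it (`1`) and finds a sign (`2`), after
which one half of the family is settled by transitivity. -/
theorem can_binary_search_of_card_lt {α : Type*} {s : KState X} {c : ℕ} {g : α → X → ℝ} {h : X → ℝ}
    (hh : Known h s) (k : ℕ) : ∀ (F : Finset α), F.card < 2 ^ k →
      (∀ a ∈ F, Can s c (Known (g a))) →
      (∀ a ∈ F, ∀ b ∈ F, SignKnown (fun x => g a x - g b x) s) →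
      Can s (k * (c + 3)) fun t => ∀ a ∈ F, SignKnown (fun x => h x - g a x) t := by
  classical
  induction k with
  | zero =>
    intro F hF _ _ t _
    have : F = ∅ := by simpa using hF
    exact .done (by simp [this])
  | succ k ih =>
    intro F hF hg hs
    rcases F.eq_empty_or_nonempty with rfl | hne
    · exact fun t _ => .done (by simp)
    rcases s.dom.eq_empty_or_nonempty with he | ⟨x₀, hx₀⟩
    · refine fun t ht => .done fun a _ => ⟨0, fun x hx => ?_⟩
      have := ht.2 hx
      simp [he] at this
    -- The family is ordered in the same way for all inputs that lead here, so a sample input `x₀`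
    -- determines the median and both halves.
    obtain ⟨m, hm, hm1, hm2⟩ := F.exists_median hne fun a => g a x₀
    have hcmp : ∀ a ∈ F, ∀ x ∈ s.dom,
        SignType.sign (g a x - g m x) = SignType.sign (g a x₀ - g m x₀) :=
      fun a ha x hx => (hs a ha m hm).sign_eq hx hx₀
    have hlt : ∀ a ∈ F, ∀ x ∈ s.dom, (g a x < g m x ↔ g a x₀ < g m x₀) := fun a ha x hx => by
      rw [← sub_neg, ← sign_eq_neg_one_iff, hcmp a ha x hx, sign_eq_neg_one_iff, sub_neg]
    have hgt : ∀ a ∈ F, ∀ x ∈ s.dom, (g m x < g a x ↔ g m x₀ < g a x₀) := fun a ha x hx => by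
      rw [← sub_pos, ← sign_eq_one_iff, hcmp a ha x hx, sign_eq_one_iff, sub_pos]
    rw [add_mul, one_mul, add_comm]
    refine (((can_of_known hh 0).sub (hg m hm)).sign.mono_depth (by omega)).bind ?_
    rintro t ht ⟨σ, hσ⟩
    have recurse : ∀ p : α → Prop, 2 * (F.filter p).card ≤ F.card →
        Can t (k * (c + 3)) fun u => ∀ a ∈ F.filter p, SignKnown (fun x => h x - g a x) u := by
      intro p hp
      refine (ih (F.filter p) (by rw [pow_succ] at hF; omega) ?_ ?_).mono ht
      · exact fun a ha => hg a (Finset.mem_filter.1 ha).1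
      · exact fun a ha b hb => hs a (Finset.mem_filter.1 ha).1 b (Finset.mem_filter.1 hb).1
    rcases σ.trichotomy with rfl | rfl | rfl
    · refine (recurse _ hm1).imp fun u hu hk a ha => ?_
      by_cases hv : g a x₀ < g m x₀
      · exact hk a (Finset.mem_filter.2 ⟨ha, hv⟩)
      · refine ⟨-1, fun x hx => sign_eq_neg_one_iff.2 ?_⟩
        have h1 := sign_eq_neg_one_iff.1 (hσ x (hu.2 hx))
        have h2 := mt (hlt a ha x (ht.2 (hu.2 hx))).1 hv
        linarith
    · refine fun u hu => .done fun a ha => ?_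
      refine (monotone_signKnown _ (ht.trans hu) (hs m hm a ha)).congr fun x hx => ?_
      have h1 := sign_eq_zero_iff.1 (hσ x (hu.2 hx))
      simp only
      linarith
    · refine (recurse _ hm2).imp fun u hu hk a ha => ?_
      by_cases hv : g m x₀ < g a x₀
      · exact hk a (Finset.mem_filter.2 ⟨ha, hv⟩)
      · refine ⟨1, fun x hx => sign_eq_one_iff.2 ?_⟩
        have h1 := sign_eq_one_iff.1 (hσ x (hu.2 hx))
        have h2 := mt (hgt a ha x (ht.2 (hu.2 hx))).1 hv
        linarith

/-- Binary search: locating an available number in a family whose order is known. -/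
theorem can_binary_search {α : Type*} {s : KState X} {c : ℕ} {g : α → X → ℝ} {h : X → ℝ}
    (F : Finset α) (hh : Known h s) (hg : ∀ a ∈ F, Can s c (Known (g a)))
    (hs : ∀ a ∈ F, ∀ b ∈ F, SignKnown (fun x => g a x - g b x) s) :
    Can s ((Nat.log 2 F.card + 1) * (c + 3))
      fun t => ∀ a ∈ F, SignKnown (fun x => h x - g a x) t :=
  can_binary_search_of_card_lt hh _ F (Nat.lt_pow_succ_log_self (by norm_num) _) hg hs

/-! ### Point location among hyperplanes -/

/-- Once it is prepared, a family of linear forms can be evaluated at any available vector with a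
logarithmic number of operations, as far as the signs are concerned. -/
theorem exists_can_locate (D : ℕ) : ∃ c e : ℕ, ∀ (X : Type) (α : Type) [Fintype α] [Nonempty α]
    (s : KState X) (φ : α → Fin D → X → ℝ), Known 0 s → (∀ a m, Known (φ a m) s) →
    Can s (c * Fintype.card α ^ e) fun t => ∀ ψ : Fin D → X → ℝ, ∀ u, t ≤ u →
      (∀ m, Known (ψ m) u) → Can u (c * (Nat.log 2 (Fintype.card α) + 1))
        fun v => ∀ a, SignKnown (fun x => ∑ m, φ a m x * ψ m x) v := by
  classical
  induction D with
  | zero =>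
    refine ⟨0, 0, fun X α _ _ s φ _ _ t _ => .done fun ψ u _ _ v _ => .done fun a => ⟨0, ?_⟩⟩
    simp
  | succ D ih =>
    obtain ⟨c, e, H⟩ := ih
    -- The induction hypothesis is applied to the `N²` pairs of forms, which doubles the exponent in
    -- every dimension; the logarithm only doubles.
    refine ⟨2 * c + 6 * D + 6, 2 * e + 2, fun X α _ _ s φ h0 hφ => ?_⟩
    set N := Fintype.card α with hN
    have hN1 : 1 ≤ N := Fintype.card_pos
    have step1 : Can s (N * 2) fun t => ∀ a, SignKnown (φ a (Fin.last D)) t := by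
      refine can_forall (fun a => monotone_signKnown _) fun a => ?_
      exact (can_of_known (hφ a (Fin.last D)) 0).sign
    have hcost : N * 2 + (N * N * D * 3 + c * (N * N) ^ e) ≤
        (2 * c + 6 * D + 6) * N ^ (2 * e + 2) := by
      have h1 : N ≤ N ^ (2 * e + 2) := Nat.le_self_pow (by omega) _
      have h2 : N * N ≤ N ^ (2 * e + 2) := by
        rw [← pow_two]; exact Nat.pow_le_pow_right hN1 (by omega)
      have h3 : (N * N) ^ e ≤ N ^ (2 * e + 2) := by
        rw [← pow_two, ← pow_mul]; exact Nat.pow_le_pow_right hN1 (by omega)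
      have h4 := Nat.mul_le_mul_right (D * 3) h2
      have h5 := Nat.mul_le_mul_left c h3
      nlinarith [Nat.zero_le (c * N ^ (2 * e + 2)), Nat.zero_le (D * N ^ (2 * e + 2))]
    refine (step1.bind fun t hst ht => ?_).mono_depth hcost
    choose σ hσ using ht
    have hlast : ∀ a, σ a ≠ 0 → ∀ u, t ≤ u → ∀ x ∈ u.dom, φ a (Fin.last D) x ≠ 0 := by
      intro a ha u hu x hx h
      apply ha
      rw [← hσ a x (hu.2 hx), h, sign_zero]
    set M : α → Fin D → X → ℝ := fun a m x => φ a m.castSucc x / φ a (Fin.last D) x with hM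
    have canM : ∀ a, σ a ≠ 0 → ∀ u, t ≤ u → ∀ m, Can u 1 (Known (M a m)) := fun a ha u hu m =>
      (can_of_known (monotone_known _ (hst.trans hu) (hφ a _)) 0).div
        (can_of_known (monotone_known _ (hst.trans hu) (hφ a _)) 0) (hlast a ha u hu)
    -- If both last coefficients are nonzero, the pair carries the difference of the normalized
    -- forms, whose sign compares two thresholds for the last coordinate. Otherwise it carries the
    -- truncation of its first member, so that the pair `(a, a)` answers for a form with zero last
    -- coefficient.
    set φ' : α × α → Fin D → X → ℝ := fun ab m =>
      if σ ab.1 ≠ 0 ∧ σ ab.2 ≠ 0 then fun x => M ab.1 m x - M ab.2 m x else φ ab.1 m.castSucc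
      with hφ'
    have step2 : Can t (N * N * D * 3) fun u => ∀ i : (α × α) × Fin D, Known (φ' i.1 i.2) u := by
      have := can_forall (s := t) (d := 3)
        (P := fun (i : (α × α) × Fin D) u => Known (φ' i.1 i.2) u)
        (fun i => monotone_known _) fun i => ?_
      · simpa [Fintype.card_prod] using this
      · simp only [hφ']
        split_ifs with h
        · exact (canM _ h.1 t le_rfl i.2).sub (canM _ h.2 t le_rfl i.2)
        · exact can_of_known (monotone_known _ hst (hφ _ _)) _
    refine step2.bind fun u htu hu => ?_
    have step3 := H X (α × α) u φ' (monotone_known _ (hst.trans htu) h0) fun ab m => hu (ab, m)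
    rw [Fintype.card_prod] at step3
    refine step3.imp fun v huv hv ψ w hvw hψ => ?_
    have htw : t ≤ w := (htu.trans huv).trans hvw
    have hcost' : c * (Nat.log 2 (N * N) + 1) + (Nat.log 2 N + 1) * (3 * D + 1 + 3) ≤
        (2 * c + 6 * D + 6) * (Nat.log 2 N + 1) := by
      have hlog : Nat.log 2 (N * N) < 2 * (Nat.log 2 N + 1) := by
        apply Nat.log_lt_of_lt_pow (by positivity)
        have := Nat.lt_pow_succ_log_self (b := 2) (by norm_num) N
        calc N * N < 2 ^ (Nat.log 2 N + 1) * 2 ^ (Nat.log 2 N + 1) := Nat.mul_lt_mul'' this this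
          _ = 2 ^ (2 * (Nat.log 2 N + 1)) := by rw [← pow_add]; congr 1; ring
      have := Nat.mul_le_mul_left c (show Nat.log 2 (N * N) + 1 ≤ 2 * (Nat.log 2 N + 1) by omega)
      nlinarith [Nat.zero_le (D * (Nat.log 2 N + 1))]
    refine ((hv (fun m => ψ m.castSucc) w hvw fun m => hψ _).bind
      fun y hwy hy => ?_).mono_depth hcost'
    have hty := htw.trans hwy
    -- The threshold: with nonzero last coefficient, form `a` has the sign of that coefficient times
    -- the sign of `ψ (Fin.last D) - g a`. The lower-dimensional query has sorted these thresholds,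
    -- so binary search locates the last coordinate among them.
    set g : α → X → ℝ := fun a x => 0 - ∑ m, M a m x * ψ m.castSucc x with hg
    have hbs := can_binary_search (s := y) (c := 3 * D + 1) (g := g) (h := ψ (Fin.last D))
      (Finset.univ.filter fun a => σ a ≠ 0) (monotone_known _ hwy (hψ _)) (fun a ha => ?_)
      (fun a ha b hb => ?_)
    · refine (hbs.imp fun z hyz hz a => ?_).mono_depth
        (Nat.mul_le_mul_right _ (Nat.succ_le_succ (Nat.log_mono_right (Finset.card_le_univ _))))
      by_cases ha : σ a = 0
      · refine (monotone_signKnown _ hyz (hy (a, a))).congr fun x hx => ?_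
        have h1 : φ a (Fin.last D) x = 0 := by
          rw [← sign_eq_zero_iff, hσ a x ((hty.trans hyz).2 hx), ha]
        simp [Fin.sum_univ_castSucc, h1, hφ', ha]
      · have hl : SignKnown (φ a (Fin.last D)) z :=
          ⟨σ a, fun x hx => hσ a x ((hty.trans hyz).2 hx)⟩
        refine (hl.mul (hz a (by simp [ha]))).congr fun x hx => ?_
        have h1 := hlast a ha z (hty.trans hyz) x hx
        simp only [Fin.sum_univ_castSucc, hg, hM, zero_sub, sub_neg_eq_add]
        rw [add_comm, mul_add, Finset.mul_sum]
        congr 1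
        refine Finset.sum_congr rfl fun m _ => ?_
        field_simp
    · have ha : σ a ≠ 0 := by simpa using ha
      have h0' := monotone_known _ (hst.trans hty) h0
      have := (can_of_known h0' 0).sub (can_sum (d := 2) h0' fun m =>
        (canM a ha y hty m).mul (can_of_known (monotone_known _ hwy (hψ m.castSucc)) 0))
      exact this.mono_depth (by omega)
    · have ha : σ a ≠ 0 := by simpa using ha
      have hb : σ b ≠ 0 := by simpa using hb
      refine (hy (b, a)).congr fun x _ => ?_
      simp only [hφ', hg, ne_eq, ha, hb, not_false_eq_true, and_self, if_true, sub_mul,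
        Finset.sum_sub_distrib]
      ring

end KState

/-! ### Polynomial functions and their linearization -/

/-- Polynomial functions with integer coefficients. -/
inductive IsPolyFun {V : Type} : ((V → ℝ) → ℝ) → Prop
  | var (v : V) : IsPolyFun fun x => x v
  | one : IsPolyFun fun _ => 1
  | add {f g : (V → ℝ) → ℝ} : IsPolyFun f → IsPolyFun g → IsPolyFun fun x => f x + g x
  | sub {f g : (V → ℝ) → ℝ} : IsPolyFun f → IsPolyFun g → IsPolyFun fun x => f x - g x
  | mul {f g : (V → ℝ) → ℝ} : IsPolyFun f → IsPolyFun g → IsPolyFun fun x => f x * g x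

namespace IsPolyFun

variable {V : Type} {f g : (V → ℝ) → ℝ}

theorem zero : IsPolyFun fun _ : V → ℝ => (0 : ℝ) := by
  simpa using one.sub (V := V) one

theorem neg (hf : IsPolyFun f) : IsPolyFun fun x => -f x := by
  simpa using zero.sub hf

/-- The cost `c` counts the operations in the expression and depends on `f` alone, not on the node
or the arguments. -/
theorem exists_can (hf : IsPolyFun f) : ∃ c : ℕ, ∀ (X : Type) (s : KState X) (w : V → X → ℝ),
    KState.Known 1 s → (∀ v, KState.Known (w v) s) →
      KState.Can s c (KState.Known fun x => f fun v => w v x) := by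
  induction hf with
  | var v => exact ⟨0, fun X s w _ hw => KState.can_of_known (hw v) 0⟩
  | one => exact ⟨0, fun X s w h1 _ => KState.can_of_known h1 0⟩
  | add _ _ ih ih' =>
    obtain ⟨c, hc⟩ := ih
    obtain ⟨c', hc'⟩ := ih'
    exact ⟨c + c' + 1, fun X s w h1 hw => (hc X s w h1 hw).add (hc' X s w h1 hw)⟩
  | sub _ _ ih ih' =>
    obtain ⟨c, hc⟩ := ih
    obtain ⟨c', hc'⟩ := ih'
    exact ⟨c + c' + 1, fun X s w h1 hw => (hc X s w h1 hw).sub (hc' X s w h1 hw)⟩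
  | mul _ _ ih ih' =>
    obtain ⟨c, hc⟩ := ih
    obtain ⟨c', hc'⟩ := ih'
    exact ⟨c + c' + 1, fun X s w h1 hw => (hc X s w h1 hw).mul (hc' X s w h1 hw)⟩

/-- A polynomial in two groups of variables is a bilinear form in polynomials of each group. -/
theorem exists_bilinear {A B : Type} {f : (A ⊕ B → ℝ) → ℝ} (hf : IsPolyFun f) :
    ∃ (ι : Type) (_ : Fintype ι) (φ : ι → (A → ℝ) → ℝ) (ψ : ι → (B → ℝ) → ℝ),
      (∀ i, IsPolyFun (φ i)) ∧ (∀ i, IsPolyFun (ψ i)) ∧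
        ∀ a b, f (Sum.elim a b) = ∑ i, φ i a * ψ i b := by
  induction hf with
  | var v =>
    rcases v with v | v
    · exact ⟨Unit, inferInstance, fun _ a => a v, fun _ _ => 1, fun _ => var v, fun _ => one,
        by simp⟩
    · exact ⟨Unit, inferInstance, fun _ _ => 1, fun _ b => b v, fun _ => one, fun _ => var v,
        by simp⟩
  | one => exact ⟨Unit, inferInstance, fun _ _ => 1, fun _ _ => 1, fun _ => one, fun _ => one,
      by simp⟩
  | add _ _ ih ih' =>
    obtain ⟨ι, _, φ, ψ, hφ, hψ, h⟩ := ih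
    obtain ⟨ι', _, φ', ψ', hφ', hψ', h'⟩ := ih'
    exact ⟨ι ⊕ ι', inferInstance, Sum.elim φ φ', Sum.elim ψ ψ', by rintro (i | i) <;> simp [hφ, hφ'],
      by rintro (i | i) <;> simp [hψ, hψ'], fun a b => by simp [h, h']⟩
  | sub _ _ ih ih' =>
    obtain ⟨ι, _, φ, ψ, hφ, hψ, h⟩ := ih
    obtain ⟨ι', _, φ', ψ', hφ', hψ', h'⟩ := ih'
    refine ⟨ι ⊕ ι', inferInstance, Sum.elim φ fun i a => -φ' i a, Sum.elim ψ ψ', ?_,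
      by rintro (i | i) <;> simp [hψ, hψ'], fun a b => by simp [h, h', sub_eq_add_neg]⟩
    rintro (i | i)
    · exact hφ i
    · exact (hφ' i).neg
  | mul _ _ ih ih' =>
    obtain ⟨ι, _, φ, ψ, hφ, hψ, h⟩ := ih
    obtain ⟨ι', _, φ', ψ', hφ', hψ', h'⟩ := ih'
    refine ⟨ι × ι', inferInstance, fun i a => φ i.1 a * φ' i.2 a, fun i b => ψ i.1 b * ψ' i.2 b,
      fun i => (hφ _).mul (hφ' _), fun i => (hψ _).mul (hψ' _), fun a b => ?_⟩
    simp only [h, h', Fintype.sum_mul_sum, Fintype.sum_prod_type]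
    exact Finset.sum_congr rfl fun i _ => Finset.sum_congr rfl fun j _ => by ring

end IsPolyFun

/-! ### Elimination of square roots from sign conditions -/

/-- The sign of `f` is a function of the signs of finitely many polynomials. -/
def SignDet {V : Type} (f : (V → ℝ) → ℝ) : Prop :=
  ∃ G : Finset ((V → ℝ) → ℝ), (∀ g ∈ G, IsPolyFun g) ∧
    ∀ x y, (∀ g ∈ G, SignType.sign (g x) = SignType.sign (g y)) →
      SignType.sign (f x) = SignType.sign (f y)

theorem IsPolyFun.signDet {V : Type} {f : (V → ℝ) → ℝ} (hf : IsPolyFun f) : SignDet f :=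
  ⟨{f}, by simpa using hf, fun x y h => h f (by simp)⟩

namespace SignDet

variable {V : Type} {f g h : (V → ℝ) → ℝ}

theorem map (F : SignType → SignType) (hf : SignDet f)
    (hh : ∀ x, SignType.sign (h x) = F (SignType.sign (f x))) : SignDet h := by
  obtain ⟨G, hG, hd⟩ := hf
  exact ⟨G, hG, fun x y hxy => by rw [hh, hh, hd x y hxy]⟩

theorem map₂ (F : SignType → SignType → SignType) (hf : SignDet f) (hg : SignDet g)
    (hh : ∀ x, SignType.sign (h x) = F (SignType.sign (f x)) (SignType.sign (g x))) :
    SignDet h := by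
  classical
  obtain ⟨G, hG, hd⟩ := hf
  obtain ⟨G', hG', hd'⟩ := hg
  refine ⟨G ∪ G', fun k hk => (Finset.mem_union.1 hk).elim (hG k) (hG' k), fun x y hxy => ?_⟩
  rw [hh, hh, hd x y fun k hk => hxy k (Finset.mem_union_left _ hk),
    hd' x y fun k hk => hxy k (Finset.mem_union_right _ hk)]

theorem map₃ {k : (V → ℝ) → ℝ} (F : SignType → SignType → SignType → SignType) (hf : SignDet f)
    (hg : SignDet g) (hk : SignDet k) (hh : ∀ x, SignType.sign (h x) =
      F (SignType.sign (f x)) (SignType.sign (g x)) (SignType.sign (k x))) :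
    SignDet h := by
  classical
  obtain ⟨G, hG, hd⟩ := hf
  obtain ⟨G', hG', hd'⟩ := hg
  obtain ⟨H, hH, hd''⟩ := hk
  refine ⟨G ∪ G' ∪ H, fun k hk => ?_, fun x y hxy => ?_⟩
  · simp only [Finset.mem_union] at hk
    exact hk.elim (fun hk => hk.elim (hG k) (hG' k)) (hH k)
  · simp only [Finset.mem_union] at hxy
    rw [hh, hh, hd x y fun k hk => hxy k (.inl (.inl hk)),
      hd' x y fun k hk => hxy k (.inl (.inr hk)), hd'' x y fun k hk => hxy k (.inr hk)]

theorem neg (hf : SignDet f) : SignDet fun x => -f x :=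
  hf.map (fun a => -a) fun _ => Left.sign_neg _

theorem mul (hf : SignDet f) (hg : SignDet g) : SignDet fun x => f x * g x :=
  hf.map₂ (· * ·) hg fun _ => sign_mul _ _

theorem div (hf : SignDet f) (hg : SignDet g) : SignDet fun x => f x / g x :=
  hf.map₂ (· * ·) hg fun x => by
    rw [div_eq_mul_inv, sign_mul]
    rcases lt_trichotomy (g x) 0 with h | h | h
    · rw [sign_neg h, sign_neg (inv_lt_zero.2 h)]
    · simp [h]
    · rw [sign_pos h, sign_pos (inv_pos.2 h)]

theorem max (hf : SignDet f) (hg : SignDet g) : SignDet fun x => Max.max (f x) (g x) :=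
  hf.map₂ Max.max hg fun _ => (SignType.sign (α := ℝ)).monotone.map_max

theorem min (hf : SignDet f) (hg : SignDet g) : SignDet fun x => Min.min (f x) (g x) :=
  hf.map₂ Min.min hg fun _ => (SignType.sign (α := ℝ)).monotone.map_min

theorem ite (R : SignType → Prop) [DecidablePred R] {p : (V → ℝ) → Prop} [DecidablePred p]
    (hh : SignDet h) (hp : ∀ x, p x ↔ R (SignType.sign (h x))) (hf : SignDet f) (hg : SignDet g) :
    SignDet fun x => if p x then f x else g x :=
  hh.map₃ (fun a b c => if R a then b else c) hf hg fun x => by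
    by_cases hx : p x
    · simp [hx, (hp x).1 hx]
    · simp [hx, mt (hp x).2 hx]

theorem ite_eq_zero (hh : SignDet h) (hf : SignDet f) (hg : SignDet g) :
    SignDet fun x => if h x = 0 then f x else g x :=
  ite (· = 0) hh (fun _ => sign_eq_zero_iff.symm) hf hg

theorem ite_neg (hh : SignDet h) (hf : SignDet f) (hg : SignDet g) :
    SignDet fun x => if h x < 0 then f x else g x :=
  ite (· = -1) hh (fun _ => sign_eq_neg_one_iff.symm) hf hg

theorem ite_nonpos (hh : SignDet h) (hf : SignDet f) (hg : SignDet g) :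
    SignDet fun x => if h x ≤ 0 then f x else g x :=
  ite (· ≠ 1) hh (fun x => by rw [ne_eq, sign_eq_one_iff, not_lt]) hf hg

end SignDet

/-- The sign of `x + y √b` as a function of the signs of `x`, `y`, `b` and `x² - y² b`. -/
theorem sign_add_mul_sqrt (x y b : ℝ) : SignType.sign (x + y * √b) =
    if b ≤ 0 then SignType.sign x else if y = 0 then SignType.sign x
      else if x = 0 then SignType.sign y
      else if SignType.sign x = SignType.sign y then SignType.sign x
      else SignType.sign x * SignType.sign (x * x - y * y * b) := by
  split_ifs with hb hy hx hxy
  · simp [Real.sqrt_eq_zero_of_nonpos hb]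
  · simp [hy]
  · simp [hx, sign_mul, Real.sqrt_pos.2 (not_le.1 hb)]
  · have ht := Real.sqrt_pos.2 (not_le.1 hb)
    rcases lt_or_gt_of_ne hx with h | h
    · rw [sign_neg h] at hxy ⊢
      have := sign_eq_neg_one_iff.1 hxy.symm
      exact sign_eq_neg_one_iff.2 (by nlinarith [mul_pos_of_neg_of_neg this (neg_lt_zero.2 ht)])
    · rw [sign_pos h] at hxy ⊢
      have := sign_eq_one_iff.1 hxy.symm
      exact sign_eq_one_iff.2 (by positivity)
  · have ht := Real.sqrt_pos.2 (not_le.1 hb)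
    -- Here `x` and `y` have opposite signs, so the conjugate `x - y √b` has the sign of `x` and can
    -- be divided out.
    have hE : x * x - y * y * b = (x - y * √b) * (x + y * √b) := by
      nlinarith [Real.mul_self_sqrt (not_le.1 hb).le]
    rw [hE, sign_mul, ← mul_assoc]
    rcases lt_or_gt_of_ne hx with h | h
    · rw [sign_neg h] at hxy ⊢
      have hy' : 0 < y := lt_of_le_of_ne (by
        by_contra! h'
        exact hxy (sign_neg h').symm) (Ne.symm hy)
      rw [sign_neg (show x - y * √b < 0 by nlinarith [mul_pos hy' ht])]
      simp
    · rw [sign_pos h] at hxy ⊢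
      have hy' : y < 0 := lt_of_le_of_ne (by
        by_contra! h'
        exact hxy (sign_pos h').symm) hy
      rw [sign_pos (show 0 < x - y * √b by nlinarith [mul_pos_of_neg_of_neg hy' (neg_lt_zero.2 ht)])]
      simp

namespace SignDet

variable {V : Type} {x y b c d d' s s' : (V → ℝ) → ℝ}

/-- The norm `x² - y² b` is a separate hypothesis because `x` may itself contain a root: determined
signs are closed under products, but not under differences. -/
theorem add_mul_sqrt (hx : SignDet x) (hy : SignDet y) (hb : SignDet b)
    (hE : SignDet fun v => x v * x v - y v * y v * b v) : SignDet fun v => x v + y v * √(b v) := by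
  have h : SignDet fun v => if b v ≤ 0 then x v else if y v = 0 then x v
      else if x v = 0 then y v
      else if x v * y v ≤ 0 then x v * (x v * x v - y v * y v * b v) else x v :=
    ite_nonpos hb hx (ite_eq_zero hy hx (ite_eq_zero hx hy
      (ite_nonpos (hx.mul hy) (hx.mul hE) hx)))
  refine h.map id fun v => ?_
  rw [sign_add_mul_sqrt]
  split_ifs with h1 h2 h3 h4 h5 h5
  · rfl
  · rfl
  · rfl
  · exfalso
    rcases lt_or_gt_of_ne h3 with h | h
    · rw [sign_neg h] at h4
      exact absurd h5 (not_le.2 (mul_pos_of_neg_of_neg h (sign_eq_neg_one_iff.1 h4.symm)))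
    · rw [sign_pos h] at h4
      exact absurd h5 (not_le.2 (mul_pos h (sign_eq_one_iff.1 h4.symm)))
  · rfl
  · exact (sign_mul _ _).symm
  · exfalso
    rcases pos_and_pos_or_neg_and_neg_of_mul_pos (not_le.1 h5) with h | h
    · exact h4 (by rw [sign_pos h.1, sign_pos h.2])
    · exact h4 (by rw [sign_neg h.1, sign_neg h.2])

theorem poly_add_sqrt (hc : IsPolyFun c) (hs : IsPolyFun s) (hd : IsPolyFun d) :
    SignDet fun v => c v + s v * √(d v) :=
  add_mul_sqrt hc.signDet hs.signDet hd.signDet ((hc.mul hc).sub ((hs.mul hs).mul hd)).signDet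

/-- Squaring removes the second root: the norm of the sum with respect to `√d'` contains only the
root `√d`, and one more squaring leaves polynomials. -/
theorem poly_add_sqrt_add_sqrt (hc : IsPolyFun c) (hs : IsPolyFun s) (hd : IsPolyFun d)
    (hs' : IsPolyFun s') (hd' : IsPolyFun d') :
    SignDet fun v => c v + s v * √(d v) + s' v * √(d' v) := by
  refine add_mul_sqrt (poly_add_sqrt hc hs hd) hs'.signDet hd'.signDet ?_
  -- Since `√` is `0` at negative numbers, replacing `√d * √d` by `d` is valid only for `0 ≤ d`.
  have h : SignDet fun v => if d v ≤ 0 then c v * c v - s' v * s' v * d' v else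
      (c v * c v + s v * s v * d v - s' v * s' v * d' v) + (c v * s v + c v * s v) * √(d v) :=
    ite_nonpos hd.signDet ((hc.mul hc).sub ((hs'.mul hs').mul hd')).signDet
      (poly_add_sqrt (((hc.mul hc).add ((hs.mul hs).mul hd)).sub ((hs'.mul hs').mul hd'))
        ((hc.mul hs).add (hc.mul hs)) hd)
  convert h using 2 with v
  split_ifs with h0
  · simp [Real.sqrt_eq_zero_of_nonpos h0]
  · nlinarith [Real.mul_self_sqrt (not_le.1 h0).le]

end SignDet

/-! ### Point location for polynomials and for sign-determined functions -/

namespace KState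

variable {X : Type*} {B : Type*}

/-- For every available vector `z`, the property `P z` can be achieved with `c` operations. -/
def Answers (c : ℕ) (P : (B → X → ℝ) → KState X → Prop) (t : KState X) : Prop :=
  ∀ z u, t ≤ u → (∀ j, Known (z j) u) → Can u c (P z)

theorem monotone_answers (c : ℕ) (P : (B → X → ℝ) → KState X → Prop) : Monotone (Answers c P) :=
  fun _ _ h ht z u hu hz => ht z u (h.trans hu) hz

theorem can_zero {s : KState X} (h : Known 1 s) : Can s 1 (Known 0) :=
  ((can_of_known h 0).sub (can_of_known h 0)).congr_known fun x _ => by simp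

end KState

open KState

/-- Bilinearization turns the polynomial, at each prepared point, into a linear form in `D`
functions of the query point, where `D` depends on `f` only. The forms are prepared once, and a
query evaluates the `D` functions before locating them. -/
theorem IsPolyFun.exists_can_locate {A B : Type} {f : (A ⊕ B → ℝ) → ℝ} (hf : IsPolyFun f) :
    ∃ c e : ℕ, ∀ (X α : Type) [Fintype α] [Nonempty α] (s : KState X) (w : α → A → X → ℝ),
      Known 1 s → (∀ a i, Known (w a i) s) →
      Can s (c * Fintype.card α ^ e) (Answers (c * (Nat.log 2 (Fintype.card α) + 1))
        fun (z : B → X → ℝ) v => ∀ a,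
          SignKnown (fun x => f (Sum.elim (fun i => w a i x) fun j => z j x)) v) := by
  obtain ⟨ι, _, φ, ψ, hφ, hψ, hfe⟩ := hf.exists_bilinear
  choose cφ hcφ using fun i => (hφ i).exists_can
  choose cψ hcψ using fun i => (hψ i).exists_can
  set D := Fintype.card ι
  set q : ι ≃ Fin D := Fintype.equivFin ι
  obtain ⟨c, e, H⟩ := KState.exists_can_locate D
  set C := ∑ i, (cφ i + cψ i)
  have hC : ∀ i, cφ i + cψ i ≤ C := fun i =>
    Finset.single_le_sum (f := fun i => cφ i + cψ i) (fun _ _ => Nat.zero_le _) (Finset.mem_univ i)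
  refine ⟨1 + D * C + c, e + 1, fun X α _ _ s w h1 hw => ?_⟩
  set N := Fintype.card α
  have hN : 1 ≤ N := Fintype.card_pos
  have hcost : 1 + (N * D * C + c * N ^ e) ≤ (1 + D * C + c) * N ^ (e + 1) := by
    have h2 : N ≤ N ^ (e + 1) := Nat.le_self_pow (by omega) _
    have h3 : N ^ e ≤ N ^ (e + 1) := Nat.pow_le_pow_right hN (by omega)
    have h4 := Nat.mul_le_mul_right (D * C) h2
    have h5 := Nat.mul_le_mul_left c h3
    nlinarith
  refine ((can_zero h1).bind fun t ht h0 => ?_).mono_depth hcost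
  have hpre : Can t (N * D * C) fun u => ∀ i : α × Fin D,
      Known (fun x => φ (q.symm i.2) fun j => w i.1 j x) u := by
    have := can_forall (s := t) (d := C)
      (P := fun (i : α × Fin D) u => Known (fun x => φ (q.symm i.2) fun j => w i.1 j x) u)
      (fun i => monotone_known _) fun i => ?_
    · simpa [Fintype.card_prod] using this
    · exact (hcφ (q.symm i.2) X t (w i.1) (monotone_known _ ht h1)
        fun j => monotone_known _ ht (hw _ _)).mono_depth (by have := hC (q.symm i.2); omega)
  refine hpre.bind fun u htu hu => ?_
  refine (H X α u (fun a m x => φ (q.symm m) fun j => w a j x) (monotone_known _ htu h0)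
    fun a m => hu (a, m)).imp fun v huv hv z y hvy hz => ?_
  have hquery : Can y (D * C) fun u => ∀ m : Fin D,
      Known (fun x => ψ (q.symm m) fun j => z j x) u := by
    have := can_forall (s := y) (d := C)
      (P := fun (m : Fin D) u => Known (fun x => ψ (q.symm m) fun j => z j x) u)
      (fun i => monotone_known _) fun m => ?_
    · simpa using this
    · exact (hcψ (q.symm m) X y z
        (monotone_known _ (((ht.trans htu).trans huv).trans hvy) h1) hz).mono_depth
          (by have := hC (q.symm m); omega)
  refine (hquery.bind fun r hyr hr => hv (fun m x => ψ (q.symm m) fun j => z j x) r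
    (hvy.trans hyr) hr).mono_depth (?_ : _ ≤ (1 + D * C + c) * (Nat.log 2 N + 1)) |>.imp
      fun r _ hr a => (hr a).congr fun x _ => ?_
  · nlinarith [Nat.zero_le (D * C * Nat.log 2 N)]
  · rw [hfe, ← q.symm.sum_comp]

/-- A finite family of functions with determined signs can be evaluated, as far as the signs are
concerned, for the points of a prepared family in the first group of variables and arbitrary
points in the second group. -/
theorem SignDet.exists_can_locate {A B κ : Type} [Fintype κ] {f : κ → (A ⊕ B → ℝ) → ℝ}
    (hf : ∀ k, SignDet (f k)) :
    ∃ c e : ℕ, ∀ (X α : Type) [Fintype α] [Nonempty α] (s : KState X) (w : α → A → X → ℝ),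
      Known 1 s → (∀ a i, Known (w a i) s) →
      Can s (c * Fintype.card α ^ e) (Answers (c * (Nat.log 2 (Fintype.card α) + 1))
        fun (z : B → X → ℝ) v => ∀ k a,
          SignKnown (fun x => f k (Sum.elim (fun i => w a i x) fun j => z j x)) v) := by
  classical
  choose G hG hd using hf
  choose c e H using fun (g : {g : (A ⊕ B → ℝ) → ℝ // IsPolyFun g}) => g.2.exists_can_locate
  set U : Finset {g : (A ⊕ B → ℝ) → ℝ // IsPolyFun g} :=
    Finset.univ.biUnion fun k => (G k).attach.image fun g => ⟨g.1, hG k g.1 g.2⟩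
  have hU : ∀ k, ∀ g (hg : g ∈ G k), ⟨g, hG k g hg⟩ ∈ U := fun k g hg =>
    Finset.mem_biUnion.2 ⟨k, Finset.mem_univ k, Finset.mem_image.2
      ⟨⟨g, hg⟩, Finset.mem_attach _ _, rfl⟩⟩
  set C := ∑ g ∈ U, c g
  set E := ∑ g ∈ U, e g
  have hC : ∀ g ∈ U, c g ≤ C := fun g hg =>
    Finset.single_le_sum (f := c) (fun _ _ => Nat.zero_le _) hg
  have hE : ∀ g ∈ U, e g ≤ E := fun g hg =>
    Finset.single_le_sum (f := e) (fun _ _ => Nat.zero_le _) hg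
  refine ⟨U.card * C, E, fun X α _ _ s w h1 hw => ?_⟩
  set N := Fintype.card α
  have hN : 1 ≤ N := Fintype.card_pos
  rw [mul_assoc]
  refine (can_forall_finset U (P := fun g => Answers (C * (Nat.log 2 N + 1))
    fun (z : B → X → ℝ) v => ∀ a,
      SignKnown (fun x => g.1 (Sum.elim (fun i => w a i x) fun j => z j x)) v)
    (fun g _ => monotone_answers _ _) fun g hg => ?_).imp ?_
  · refine ((H g X α s w h1 hw).mono_depth
      (Nat.mul_le_mul (hC g hg) (Nat.pow_le_pow_right hN (hE g hg)))).imp ?_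
    exact fun t _ ht z u hu hz => (ht z u hu hz).mono_depth (Nat.mul_le_mul_right _ (hC g hg))
  · intro t _ ht z u hu hz
    rw [mul_assoc]
    refine (can_forall_finset U (P := fun g v => ∀ a, SignKnown
      (fun x => g.1 (Sum.elim (fun i => w a i x) fun j => z j x)) v) (by
        intro g _ r r' hr h a
        exact monotone_signKnown _ hr (h a)) fun g hg => ht g hg z u hu hz).imp ?_
    intro v _ hv k a
    -- Two inputs that reach the same node now agree in the signs of all relevant polynomials, hence
    -- in the sign of `f k`.
    refine signKnown_of_forall fun x hx y hy => hd k _ _ fun g hg => ?_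
    exact (hv _ (hU k g hg) a).sign_eq hx hy

/-! ### Free intervals on a segment -/

noncomputable section

/-- For a point `p` and a segment from `q` to `q'`, the polynomial
`a t² - 2 u t + c = ‖p - (q + t (q' - q))‖² - 1` has the coefficients `a = edgeSq q q'`,
`u = edgeDot p q q'` and `c = offsetSq p q`. -/
def edgeSq (q q' : Fin 2 → ℝ) : ℝ :=
  (q' 0 - q 0) * (q' 0 - q 0) + (q' 1 - q 1) * (q' 1 - q 1)

/-- The inner product of `p - q` and `q' - q`. -/
def edgeDot (p q q' : Fin 2 → ℝ) : ℝ :=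
  (p 0 - q 0) * (q' 0 - q 0) + (p 1 - q 1) * (q' 1 - q 1)

/-- The squared distance of `p` and `q`, minus one. -/
def offsetSq (p q : Fin 2 → ℝ) : ℝ :=
  (p 0 - q 0) * (p 0 - q 0) + (p 1 - q 1) * (p 1 - q 1) - 1

/-- The reduced discriminant of `edgeSq q q' * t² - 2 * edgeDot p q q' * t + offsetSq p q`. -/
def edgeDiscr (p q q' : Fin 2 → ℝ) : ℝ :=
  edgeDot p q q' * edgeDot p q q' - edgeSq q q' * offsetSq p q

/-- The lower (for `false`) and upper (for `true`) end of the interval of those parameters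
`t ∈ [0, 1]` for which the point `q + t (q' - q)` has distance at most one from `p`. If there are
none, the lower end exceeds the upper one. -/
def freeEnd (p q q' : Fin 2 → ℝ) : Bool → ℝ
  | false => if edgeSq q q' = 0 then if offsetSq p q ≤ 0 then 0 else 1
      else if edgeDiscr p q q' < 0 then 1
      else max ((edgeDot p q q' + (-1) * √(edgeDiscr p q q')) / edgeSq q q') 0
  | true => if edgeSq q q' = 0 then if offsetSq p q ≤ 0 then 1 else 0
      else if edgeDiscr p q q' < 0 then 0
      else min ((edgeDot p q q' + 1 * √(edgeDiscr p q q')) / edgeSq q q') 1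

theorem freeEnd_false_nonneg (p q q' : Fin 2 → ℝ) : 0 ≤ freeEnd p q q' false := by
  unfold freeEnd
  split_ifs <;> simp

theorem freeEnd_true_le_one (p q q' : Fin 2 → ℝ) : freeEnd p q q' true ≤ 1 := by
  unfold freeEnd
  split_ifs <;> simp

theorem edgeDot_eq_zero {p q q' : Fin 2 → ℝ} (h : edgeSq q q' = 0) : edgeDot p q q' = 0 := by
  unfold edgeSq at h
  have h0 : q' 0 - q 0 = 0 := by nlinarith [mul_self_nonneg (q' 0 - q 0), mul_self_nonneg (q' 1 - q 1)]
  have h1 : q' 1 - q 1 = 0 := by nlinarith [mul_self_nonneg (q' 0 - q 0), mul_self_nonneg (q' 1 - q 1)]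
  simp [edgeDot, h0, h1]

theorem edgeSq_nonneg (q q' : Fin 2 → ℝ) : 0 ≤ edgeSq q q' :=
  add_nonneg (mul_self_nonneg _) (mul_self_nonneg _)

/-- `freeEnd` describes the free part of a segment. -/
theorem quadratic_nonpos_iff_freeEnd (p q q' : Fin 2 → ℝ) {t : ℝ} (h0 : 0 ≤ t) (h1 : t ≤ 1) :
    edgeSq q q' * t * t - 2 * edgeDot p q q' * t + offsetSq p q ≤ 0 ↔
      freeEnd p q q' false ≤ t ∧ t ≤ freeEnd p q q' true := by
  unfold freeEnd
  by_cases ha : edgeSq q q' = 0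
  · rw [ha, edgeDot_eq_zero ha]
    by_cases hc : offsetSq p q ≤ 0
    · simp [hc, h0, h1]
    · simp only [hc, if_true, if_false]
      constructor
      · intro h
        exfalso
        apply hc
        linarith
      · intro h
        linarith [h.1, h.2]
  · have ha' : 0 < edgeSq q q' := lt_of_le_of_ne (edgeSq_nonneg _ _) (Ne.symm ha)
    simp only [ha, if_false]
    -- Completing the square, with denominators cleared.
    have hsq : edgeSq q q' * (edgeSq q q' * t * t - 2 * edgeDot p q q' * t + offsetSq p q) =
        (edgeSq q q' * t - edgeDot p q q') ^ 2 - edgeDiscr p q q' := by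
      unfold edgeDiscr
      ring
    have hiff : edgeSq q q' * t * t - 2 * edgeDot p q q' * t + offsetSq p q ≤ 0 ↔
        (edgeSq q q' * t - edgeDot p q q') ^ 2 ≤ edgeDiscr p q q' := by
      rw [← sub_nonpos (b := edgeDiscr p q q'), ← hsq, mul_nonpos_iff_pos_imp_nonpos]
      simp [ha', ha'.le]
    rw [hiff]
    by_cases hd : edgeDiscr p q q' < 0
    · simp only [hd, if_true]
      constructor
      · intro h
        nlinarith [sq_nonneg (edgeSq q q' * t - edgeDot p q q')]
      · intro h
        linarith [h.1, h.2]
    · simp only [hd, if_false]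
      rw [Real.sq_le (not_lt.1 hd), max_le_iff, le_min_iff, div_le_iff₀ ha', le_div_iff₀ ha']
      constructor
      · rintro ⟨h, h'⟩
        exact ⟨⟨by linarith, h0⟩, by linarith, h1⟩
      · rintro ⟨⟨h, -⟩, h', -⟩
        exact ⟨by linarith, by linarith⟩

end

/-! ### Comparing and sorting the ends of free intervals -/

namespace SignDet

/-- Points (first group of variables) and segments (second group of variables). -/
abbrev PairVar : Type := (Fin 2 × Fin 2) ⊕ (Fin 2 × Fin 2)

theorem isPolyFun_edgeSq :
    IsPolyFun fun v : PairVar → ℝ => edgeSq (fun c => v (.inr (0, c))) fun c => v (.inr (1, c)) :=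
  (((IsPolyFun.var _).sub (.var _)).mul ((IsPolyFun.var _).sub (.var _))).add
    (((IsPolyFun.var _).sub (.var _)).mul ((IsPolyFun.var _).sub (.var _)))

theorem isPolyFun_edgeDot (k : Fin 2) :
    IsPolyFun fun v : PairVar → ℝ => edgeDot (fun c => v (.inl (k, c)))
      (fun c => v (.inr (0, c))) fun c => v (.inr (1, c)) :=
  (((IsPolyFun.var _).sub (.var _)).mul ((IsPolyFun.var _).sub (.var _))).add
    (((IsPolyFun.var _).sub (.var _)).mul ((IsPolyFun.var _).sub (.var _)))

theorem isPolyFun_offsetSq (k : Fin 2) :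
    IsPolyFun fun v : PairVar → ℝ => offsetSq (fun c => v (.inl (k, c)))
      (fun c => v (.inr (0, c))) :=
  ((((IsPolyFun.var _).sub (.var _)).mul ((IsPolyFun.var _).sub (.var _))).add
    (((IsPolyFun.var _).sub (.var _)).mul ((IsPolyFun.var _).sub (.var _)))).sub .one

theorem isPolyFun_edgeDiscr (k : Fin 2) :
    IsPolyFun fun v : PairVar → ℝ => edgeDiscr (fun c => v (.inl (k, c)))
      (fun c => v (.inr (0, c))) fun c => v (.inr (1, c)) :=
  ((isPolyFun_edgeDot k).mul (isPolyFun_edgeDot k)).sub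
    (isPolyFun_edgeSq.mul (isPolyFun_offsetSq k))

/-- To compare the ends of a free interval with `g` it suffices to compare `0`, `1` and the roots
of the quadratic polynomial with `g`. -/
theorem freeEnd_sub {g : (PairVar → ℝ) → ℝ} (k : Fin 2) (b : Bool)
    (h0 : SignDet fun v => 0 - g v) (h1 : SignDet fun v => 1 - g v)
    (hr : ∀ σ : (PairVar → ℝ) → ℝ, IsPolyFun σ → SignDet fun v =>
      (edgeDot (fun c => v (.inl (k, c))) (fun c => v (.inr (0, c))) (fun c => v (.inr (1, c))) +
        σ v * √(edgeDiscr (fun c => v (.inl (k, c))) (fun c => v (.inr (0, c)))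
          fun c => v (.inr (1, c)))) /
      edgeSq (fun c => v (.inr (0, c))) (fun c => v (.inr (1, c))) - g v) :
    SignDet fun v => freeEnd (fun c => v (.inl (k, c))) (fun c => v (.inr (0, c)))
      (fun c => v (.inr (1, c))) b - g v := by
  cases b
  · have := ite_eq_zero isPolyFun_edgeSq.signDet
      (ite_nonpos (isPolyFun_offsetSq k).signDet h0 h1)
      (ite_neg (isPolyFun_edgeDiscr k).signDet h1 ((hr _ IsPolyFun.one.neg).max h0))
    convert this using 2 with v
    simp only [freeEnd, max_sub_sub_right]
    split_ifs <;> rfl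
  · have := ite_eq_zero isPolyFun_edgeSq.signDet
      (ite_nonpos (isPolyFun_offsetSq k).signDet h1 h0)
      (ite_neg (isPolyFun_edgeDiscr k).signDet h0 ((hr _ IsPolyFun.one).min h1))
    convert this using 2 with v
    simp only [freeEnd, min_sub_sub_right]
    split_ifs <;> rfl

theorem sub_comm {V : Type} {f g : (V → ℝ) → ℝ} (h : SignDet fun v => f v - g v) :
    SignDet fun v => g v - f v := by
  simpa using h.neg

/-- Both points face the same segment, so both roots have the denominator `edgeSq`, and their
difference is a combination of two square roots divided by it. Clipping and degenerate cases only
add comparisons with `0` and `1`. -/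
theorem freeEnd_sub_freeEnd (k l : Fin 2) (b b' : Bool) :
    SignDet fun v : PairVar → ℝ =>
      freeEnd (fun c => v (.inl (k, c))) (fun c => v (.inr (0, c))) (fun c => v (.inr (1, c))) b -
      freeEnd (fun c => v (.inl (l, c))) (fun c => v (.inr (0, c))) (fun c => v (.inr (1, c))) b' := by
  have hroot0 : ∀ (k : Fin 2) (σ : (PairVar → ℝ) → ℝ), IsPolyFun σ → SignDet fun v =>
      (edgeDot (fun c => v (.inl (k, c))) (fun c => v (.inr (0, c))) (fun c => v (.inr (1, c))) +
        σ v * √(edgeDiscr (fun c => v (.inl (k, c))) (fun c => v (.inr (0, c)))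
          fun c => v (.inr (1, c)))) /
      edgeSq (fun c => v (.inr (0, c))) (fun c => v (.inr (1, c))) - 0 := by
    intro k σ hσ
    simpa only [sub_zero] using (poly_add_sqrt (isPolyFun_edgeDot k) hσ (isPolyFun_edgeDiscr k)).div
      isPolyFun_edgeSq.signDet
  have hroot1 : ∀ (k : Fin 2) (σ : (PairVar → ℝ) → ℝ), IsPolyFun σ → SignDet fun v =>
      (edgeDot (fun c => v (.inl (k, c))) (fun c => v (.inr (0, c))) (fun c => v (.inr (1, c))) +
        σ v * √(edgeDiscr (fun c => v (.inl (k, c))) (fun c => v (.inr (0, c)))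
          fun c => v (.inr (1, c)))) /
      edgeSq (fun c => v (.inr (0, c))) (fun c => v (.inr (1, c))) - 1 := by
    intro k σ hσ
    -- For a zero denominator the quotient is `0` by convention, so the difference is `-1`.
    have := ite_eq_zero isPolyFun_edgeSq.signDet IsPolyFun.one.neg.signDet
      ((poly_add_sqrt ((isPolyFun_edgeDot k).sub isPolyFun_edgeSq) hσ (isPolyFun_edgeDiscr k)).div
        isPolyFun_edgeSq.signDet)
    convert this using 2 with v
    split_ifs with h
    · simp [h]
    · field_simp
      ring
  have hconst : ∀ c : ℝ, c = 0 ∨ c = 1 → ∀ (l : Fin 2) (b' : Bool), SignDet fun v : PairVar → ℝ =>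
      freeEnd (fun c => v (.inl (l, c))) (fun c => v (.inr (0, c))) (fun c => v (.inr (1, c))) b' -
        c := by
    rintro c (rfl | rfl) l b'
    · exact freeEnd_sub l b' (IsPolyFun.zero.sub .zero).signDet (IsPolyFun.one.sub .zero).signDet
        (hroot0 l)
    · exact freeEnd_sub l b' (IsPolyFun.zero.sub .one).signDet (IsPolyFun.one.sub .one).signDet
        (hroot1 l)
  refine freeEnd_sub k b (hconst 0 (.inl rfl) l b').sub_comm (hconst 1 (.inr rfl) l b').sub_comm ?_
  intro σ hσ
  refine (freeEnd_sub l b' (hroot0 k σ hσ).sub_comm (hroot1 k σ hσ).sub_comm ?_).sub_comm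
  intro τ hτ
  have := (poly_add_sqrt_add_sqrt ((isPolyFun_edgeDot l).sub (isPolyFun_edgeDot k)) hτ
    (isPolyFun_edgeDiscr l) hσ.neg (isPolyFun_edgeDiscr k)).div isPolyFun_edgeSq.signDet
  convert this using 2 with v
  rw [← sub_div]
  congr 1
  ring

end SignDet

open KState

/-- After preprocessing `N` points, the order of the ends of all free intervals on a segment can be
found with a logarithmic number of operations. -/
theorem exists_can_sort_freeEnds :
    ∃ c e : ℕ, ∀ (X α : Type) [Fintype α] [Nonempty α] (s : KState X) (p : α → Fin 2 → X → ℝ),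
      Known 1 s → (∀ a i, Known (p a i) s) →
      Can s (c * Fintype.card α ^ e) (Answers (c * (Nat.log 2 (Fintype.card α) + 1))
        fun (z : Fin 2 × Fin 2 → X → ℝ) v => ∀ a a' b b', SignKnown (fun x =>
          freeEnd (fun i => p a i x) (fun i => z (0, i) x) (fun i => z (1, i) x) b -
          freeEnd (fun i => p a' i x) (fun i => z (0, i) x) (fun i => z (1, i) x) b') v) := by
  obtain ⟨c, e, H⟩ := SignDet.exists_can_locate fun k : Bool × Bool =>
    SignDet.freeEnd_sub_freeEnd 0 1 k.1 k.2
  refine ⟨2 * c, 2 * e, fun X α _ _ s p h1 hp => ?_⟩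
  -- Comparing two ends involves two points at once, so pairs of points are prepared; this doubles
  -- the exponent.
  have h := H X (α × α) s (fun a i => p (if i.1 = 0 then a.1 else a.2) i.2) h1 fun a i => hp _ _
  rw [Fintype.card_prod, ← pow_two, ← pow_mul] at h
  refine (h.mono_depth (Nat.mul_le_mul_right _ (by omega))).imp fun t _ ht z u hu hz => ?_
  refine ((ht z u hu hz).mono_depth ?_).imp fun v _ hv a a' b b' => ?_
  · have hlog : Nat.log 2 (Fintype.card α ^ 2) < 2 * (Nat.log 2 (Fintype.card α) + 1) := by
      apply Nat.log_lt_of_lt_pow (by positivity)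
      rw [mul_comm 2, pow_mul]
      exact Nat.pow_lt_pow_left (Nat.lt_pow_succ_log_self (by norm_num) _) (by norm_num)
    have := Nat.mul_le_mul_left c
      (show Nat.log 2 (Fintype.card α ^ 2) + 1 ≤ 2 * (Nat.log 2 (Fintype.card α) + 1) by omega)
    nlinarith
  · simpa using hv (b, b') (a, a')

/-! ### Computing the ends of free intervals -/

namespace KState

variable {X : Type*} {s : KState X} {u w : X → ℝ} {d e : ℕ}

theorem SignKnown.cases {f : X → ℝ} (h : SignKnown f s) :
    (∀ x ∈ s.dom, f x < 0) ∨ (∀ x ∈ s.dom, f x = 0) ∨ ∀ x ∈ s.dom, 0 < f x := by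
  obtain ⟨σ, hσ⟩ := h
  rcases σ.trichotomy with rfl | rfl | rfl
  · exact .inl fun x hx => sign_eq_neg_one_iff.1 (hσ x hx)
  · exact .inr (.inl fun x hx => sign_eq_zero_iff.1 (hσ x hx))
  · exact .inr (.inr fun x hx => sign_eq_one_iff.1 (hσ x hx))

theorem SignKnown.le_or_lt (h : SignKnown (fun x => u x - w x) s) :
    (∀ x ∈ s.dom, u x ≤ w x) ∨ ∀ x ∈ s.dom, w x < u x := by
  rcases h.cases with h | h | h
  · exact .inl fun x hx => (sub_neg.1 (h x hx)).le
  · exact .inl fun x hx => (sub_eq_zero.1 (h x hx)).le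
  · exact .inr fun x hx => sub_pos.1 (h x hx)

theorem Can.max (hu : Can s d (Known u)) (hw : Can s e (Known w)) :
    Can s (d + e + 3) (Known fun x => max (u x) (w x)) :=
  (hu.and (monotone_known u) hw).bind fun _ _ h =>
    (((can_of_known h.1 0).sub (can_of_known h.2 0)).sign).imp fun v hv hs => by
      rcases hs.le_or_lt with hs | hs
      · exact (monotone_known _ hv h.2).congr fun x hx => max_eq_right (hs x hx)
      · exact (monotone_known _ hv h.1).congr fun x hx => max_eq_left (hs x hx).le

theorem Can.min (hu : Can s d (Known u)) (hw : Can s e (Known w)) :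
    Can s (d + e + 3) (Known fun x => min (u x) (w x)) :=
  (hu.and (monotone_known u) hw).bind fun _ _ h =>
    (((can_of_known h.1 0).sub (can_of_known h.2 0)).sign).imp fun v hv hs => by
      rcases hs.le_or_lt with hs | hs
      · exact (monotone_known _ hv h.1).congr fun x hx => min_eq_left (hs x hx)
      · exact (monotone_known _ hv h.2).congr fun x hx => min_eq_right (hs x hx).le

theorem can_ite {p : X → Prop} [DecidablePred p]
    (h : (∀ x ∈ s.dom, p x) ∨ ∀ x ∈ s.dom, ¬ p x)
    (hu : (∀ x ∈ s.dom, p x) → Can s d (Known u)) (hw : (∀ x ∈ s.dom, ¬ p x) → Can s d (Known w)) :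
    Can s d (Known fun x => if p x then u x else w x) := by
  rcases h with h | h
  · exact (hu h).congr_known fun x hx => if_pos (h x hx)
  · exact (hw h).congr_known fun x hx => if_neg (h x hx)

end KState

/-- The ends of free intervals can be computed. -/
theorem exists_can_freeEnd : ∃ c : ℕ, ∀ (X : Type) (s : KState X) (p q q' : Fin 2 → X → ℝ),
    Known 1 s → (∀ i, Known (p i) s) → (∀ i, Known (q i) s) → (∀ i, Known (q' i) s) → ∀ b,
      Can s c (Known fun x => freeEnd (fun i => p i x) (fun i => q i x) (fun i => q' i x) b) := by
  obtain ⟨cA, hA⟩ := SignDet.isPolyFun_edgeSq.exists_can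
  obtain ⟨cU, hU⟩ := (SignDet.isPolyFun_edgeDot 0).exists_can
  obtain ⟨cC, hC⟩ := (SignDet.isPolyFun_offsetSq 0).exists_can
  obtain ⟨cD, hD⟩ := (SignDet.isPolyFun_edgeDiscr 0).exists_can
  refine ⟨((cA + 2) + (cC + 2) + (cD + 2)) + (cA + cU + cD + 12), fun X s p q q' h1 hp hq hq' b => ?_⟩
  set A : X → ℝ := fun x => edgeSq (fun i => q i x) fun i => q' i x with hAdef
  set U : X → ℝ := fun x => edgeDot (fun i => p i x) (fun i => q i x) fun i => q' i x with hUdef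
  set C : X → ℝ := fun x => offsetSq (fun i => p i x) fun i => q i x with hCdef
  set D : X → ℝ := fun x => edgeDiscr (fun i => p i x) (fun i => q i x) fun i => q' i x with hDdef
  have hv : ∀ i : SignDet.PairVar, Known (Sum.elim (fun k => p k.2)
      (fun k => if k.1 = 0 then q k.2 else q' k.2) i) s := by
    rintro (i | ⟨k, i⟩)
    · exact hp _
    · fin_cases k
      · exact hq _
      · exact hq' _
  have hA' : Can s cA (Known A) := by simpa using hA X s _ h1 hv
  have hU' : Can s cU (Known U) := by simpa using hU X s _ h1 hv
  have hC' : Can s cC (Known C) := by simpa using hC X s _ h1 hv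
  have hD' : Can s cD (Known D) := by simpa using hD X s _ h1 hv
  -- The three signs are settled first; in each case it is then clear which formula applies, and its
  -- division and root are defined.
  refine ((hA'.sign.and (monotone_signKnown _) hC'.sign).and (fun _ _ h ht =>
    ⟨monotone_signKnown _ h ht.1, monotone_signKnown _ h ht.2⟩) hD'.sign).bind ?_
  rintro t ht ⟨⟨sA, sC⟩, sD⟩
  have k1 : ∀ d, Can t d (Known fun _ => 1) := can_of_known (monotone_known _ ht h1)
  have k0 : ∀ d, 1 ≤ d → Can t d (Known fun _ => 0) :=
    fun d hd => (can_zero (monotone_known _ ht h1)).mono_depth hd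
  have dA : (∀ x ∈ t.dom, A x = 0) ∨ ∀ x ∈ t.dom, ¬ A x = 0 := by
    rcases sA.cases with h | h | h
    · exact .inr fun x hx => (h x hx).ne
    · exact .inl h
    · exact .inr fun x hx => (h x hx).ne'
  have dC : (∀ x ∈ t.dom, C x ≤ 0) ∨ ∀ x ∈ t.dom, ¬ C x ≤ 0 := by
    rcases sC.cases with h | h | h
    · exact .inl fun x hx => (h x hx).le
    · exact .inl fun x hx => (h x hx).le
    · exact .inr fun x hx => not_le.2 (h x hx)
  have dD : (∀ x ∈ t.dom, D x < 0) ∨ ∀ x ∈ t.dom, ¬ D x < 0 := by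
    rcases sD.cases with h | h | h
    · exact .inl h
    · exact .inr fun x hx => (h x hx).not_lt
    · exact .inr fun x hx => (h x hx).le.not_gt
  cases b
  · simp only [freeEnd]
    refine can_ite dA (fun _ => can_ite dC (fun _ => k0 _ (by omega)) fun _ => k1 _) fun a0 =>
      can_ite dD (fun _ => k1 _) fun d0 => ?_
    exact ((((hU'.mono ht).add (((k0 1 le_rfl).sub (k1 0)).congr_known (w := fun _ => -1)
      (fun x _ => by simp) |>.mul ((hD'.mono ht).sqrt fun x hx => not_lt.1 (d0 x hx)))).div
      (hA'.mono ht) a0).max (k0 1 le_rfl)).mono_depth (by omega)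
  · simp only [freeEnd]
    refine can_ite dA (fun _ => can_ite dC (fun _ => k1 _) fun _ => k0 _ (by omega)) fun a0 =>
      can_ite dD (fun _ => k0 _ (by omega)) fun d0 => ?_
    exact ((((hU'.mono ht).add ((k1 0).mul ((hD'.mono ht).sqrt fun x hx => not_lt.1 (d0 x hx)))).div
      (hA'.mono ht) a0).min (k1 0)).mono_depth (by omega)

/-! ### Propagating reachable parts through blocks of cells -/

/-- Passing through a cell of the free space diagram. The reachable part of the side by which the
cell is left starts at `gridStep b a l r` if its free part is `[l, r]`, the reachable part of the
opposite side starts at `a`, and the reachable part of the other entrance side starts at `b`. The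
value `2` indicates an empty set. -/
noncomputable def gridStep (b a l r : ℝ) : ℝ :=
  if (if b ≤ 1 then l else max a l) ≤ r then (if b ≤ 1 then l else max a l) else 2

namespace KState

variable {X : Type*}

/-- It is known whether the reachable part that starts at `f` is empty. -/
def Status (f : X → ℝ) (s : KState X) : Prop :=
  (∀ x ∈ s.dom, f x = 2) ∨ ∀ x ∈ s.dom, f x ≤ 1

/-- The function `f` is available, and its status is known. -/
def KnownStatus (f : X → ℝ) (s : KState X) : Prop := Known f s ∧ Status f s

theorem monotone_status (f : X → ℝ) : Monotone (Status f) := by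
  rintro s t h (hs | hs)
  · exact .inl fun x hx => hs x (h.2 hx)
  · exact .inr fun x hx => hs x (h.2 hx)

theorem monotone_knownStatus (f : X → ℝ) : Monotone (KnownStatus f) := fun _ _ h hs =>
  ⟨monotone_known f h hs.1, monotone_status f h hs.2⟩

/-- `f` is two everywhere, or it is at most one everywhere and agrees with a function from `F`. -/
def StatusIn (F : Set (X → ℝ)) (s : KState X) (f : X → ℝ) : Prop :=
  (∀ x ∈ s.dom, f x = 2) ∨ ((∀ x ∈ s.dom, f x ≤ 1) ∧ ∃ g ∈ F, EqOn f g s.dom)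

theorem StatusIn.status {F : Set (X → ℝ)} {s : KState X} {f : X → ℝ} (h : StatusIn F s f) :
    Status f s := h.imp id And.left

/-- No operation is needed: the emptiness of `b` and the order of `a`, `l`, `r` are the same for all
inputs at the node, hence so is the case of `gridStep` that applies. Its value is `2`, `l` or the
old start, so it stays in `F`. -/
theorem StatusIn.step {F : Set (X → ℝ)} {s : KState X} {a b l r : X → ℝ}
    (hb : Status b s) (ha : StatusIn F s a) (hl : l ∈ F)
    (hFl : ∀ f ∈ F, SignKnown (fun x => f x - l x) s)
    (hFr : ∀ f ∈ F, SignKnown (fun x => f x - r x) s) (hr : ∀ x, r x ≤ 1) :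
    StatusIn F s fun x => gridStep (b x) (a x) (l x) (r x) := by
  have key : ∀ f ∈ F, (∀ x ∈ s.dom, (if b x ≤ 1 then l x else max (a x) (l x)) = f x) →
      StatusIn F s fun x => gridStep (b x) (a x) (l x) (r x) := by
    intro f hf h
    rcases (hFr f hf).le_or_lt with hlt | hlt
    · have : ∀ x ∈ s.dom, gridStep (b x) (a x) (l x) (r x) = f x := fun x hx => by
        rw [gridStep, h x hx, if_pos (hlt x hx)]
      exact .inr ⟨fun x hx => by simpa only [this x hx] using (hlt x hx).trans (hr x), f, hf, this⟩
    · exact .inl fun x hx => by beta_reduce; rw [gridStep, h x hx, if_neg (not_le.2 (hlt x hx))]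
  rcases hb with hb | hb
  · have hb' : ∀ x ∈ s.dom, ¬ b x ≤ 1 := fun x hx => by rw [hb x hx]; norm_num
    rcases ha with ha | ⟨-, f, hf, haf⟩
    · refine .inl fun x hx => ?_
      have : ¬ max (a x) (l x) ≤ r x := by
        rw [ha x hx, max_le_iff]
        intro h
        linarith [h.1, hr x]
      beta_reduce
      rw [gridStep, if_neg (hb' x hx), if_neg this]
    · rcases (hFl f hf).le_or_lt with hlt | hlt
      · refine key l hl fun x hx => ?_
        rw [if_neg (hb' x hx), haf hx, max_eq_right (hlt x hx)]
      · refine key f hf fun x hx => ?_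
        rw [if_neg (hb' x hx), haf hx, max_eq_left (hlt x hx).le]
  · exact key l hl fun x hx => if_pos (hb x hx)

/-- The functions that describe the possible starting points on a line of cells. -/
def lineStarts (τ : ℕ) (f : X → ℝ) (E : ℕ → Bool → X → ℝ) : Set (X → ℝ) :=
  {g | g = f ∨ ∃ a < τ, g = E a false}

/-- A block of `τ × τ` cells, if all relevant comparisons are known. -/
theorem statusIn_block {s : KState X} {τ : ℕ} {α β : ℕ → ℕ → X → ℝ}
    {E E' : ℕ → ℕ → Bool → X → ℝ}
    (hα : ∀ a b x, α (a + 1) b x = gridStep (β a b x) (α a b x) (E a b false x) (E a b true x))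
    (hβ : ∀ a b x, β a (b + 1) x = gridStep (α a b x) (β a b x) (E' a b false x) (E' a b true x))
    (hE : ∀ a b x, E a b true x ≤ 1) (hE' : ∀ a b x, E' a b true x ≤ 1)
    (hα0 : ∀ b < τ, Status (α 0 b) s) (hβ0 : ∀ a < τ, Status (β a 0) s)
    (hEo : ∀ b < τ, ∀ f ∈ lineStarts τ (α 0 b) (fun a => E a b), ∀ a < τ, ∀ σ,
      SignKnown (fun x => f x - E a b σ x) s)
    (hEo' : ∀ a < τ, ∀ f ∈ lineStarts τ (β a 0) (fun b => E' a b), ∀ b < τ, ∀ σ,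
      SignKnown (fun x => f x - E' a b σ x) s) :
    (∀ b < τ, StatusIn (lineStarts τ (α 0 b) fun a => E a b) s (α τ b)) ∧
      ∀ a < τ, StatusIn (lineStarts τ (β a 0) fun b => E' a b) s (β a τ) := by
  have row : ∀ b < τ, (∀ a < τ, StatusIn (lineStarts τ (β a 0) fun b => E' a b) s (β a b)) →
      ∀ a ≤ τ, StatusIn (lineStarts τ (α 0 b) fun a => E a b) s (α a b) := by
    intro b hb hcol a
    induction a with
    | zero => exact fun _ => (hα0 b hb).imp id fun h => ⟨h, _, .inl rfl, fun _ _ => rfl⟩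
    | succ a ih =>
      intro ha
      rw [show α (a + 1) b = _ from funext (hα a b)]
      exact .step (hcol a ha).status (ih (by omega)) (.inr ⟨a, ha, rfl⟩)
        (fun f hf => hEo b hb f hf a ha false) (fun f hf => hEo b hb f hf a ha true) (hE a b)
  -- Induction on the height: the lower sides at height `b` decide the whole row `b`, whose left
  -- sides in turn decide the lower sides at height `b + 1`.
  have col : ∀ b ≤ τ, ∀ a < τ, StatusIn (lineStarts τ (β a 0) fun b => E' a b) s (β a b) := by
    intro b
    induction b with
    | zero => exact fun _ a ha => (hβ0 a ha).imp id fun h => ⟨h, _, .inl rfl, fun _ _ => rfl⟩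
    | succ b ih =>
      intro hb a ha
      rw [show β a (b + 1) = _ from funext (hβ a b)]
      exact .step (row b hb (ih (by omega)) a ha.le).status (ih (by omega) a ha)
        (.inr ⟨b, hb, rfl⟩) (fun f hf => hEo' a ha f hf b hb false)
        (fun f hf => hEo' a ha f hf b hb true) (hE' a b)
  exact ⟨fun b hb => row b hb (col b hb.le) τ le_rfl, col τ le_rfl⟩

/-- Even an output of a large block is cheap: it is the constant `2`, the start that entered the
line, or one free end, which is computed directly. -/
theorem can_knownStatus_of_statusIn {s : KState X} {τ c : ℕ} {f g : X → ℝ}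
    {E : ℕ → Bool → X → ℝ} (h1 : Known 1 s) (hf : Known f s)
    (hE : ∀ a, Can s c (Known (E a false))) (hg : StatusIn (lineStarts τ f E) s g) :
    Can s (c + 1) (KnownStatus g) := by
  have : Can s (c + 1) (Known g) := by
    rcases hg with hg | ⟨-, k, rfl | ⟨a, -, rfl⟩, hk⟩
    · refine (((can_of_known h1 0).add (can_of_known h1 0)).congr_known fun x hx => ?_).mono_depth
        (by omega)
      rw [hg x hx]
      norm_num
    · exact (can_of_known hf _).congr_known hk
    · exact ((hE a).congr_known hk).mono_depth (by omega)
  exact this.imp fun t ht hk => ⟨hk, monotone_status g ht hg.status⟩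

/-- The free ends are already sorted, so only the entering start `f` has to be located among these
`2τ` numbers. -/
theorem can_line {s : KState X} {τ c : ℕ} (hτ : 1 ≤ τ) {f : X → ℝ} {E : ℕ → Bool → X → ℝ}
    (hf : Known f s) (hE : ∀ a σ, Can s c (Known (E a σ)))
    (ho : ∀ a < τ, ∀ a' < τ, ∀ σ σ', SignKnown (fun x => E a σ x - E a' σ' x) s) :
    Can s ((Nat.log 2 τ + 2) * (c + 3)) fun t => ∀ g ∈ lineStarts τ f E, ∀ a < τ, ∀ σ,
      SignKnown (fun x => g x - E a σ x) t := by
  have h := can_binary_search (s := s) (c := c) (g := fun i : Fin τ × Bool => E i.1 i.2) (h := f)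
    Finset.univ hf (fun i _ => hE _ _) fun i _ i' _ => ho _ i.1.2 _ i'.1.2 _ _
  have hcard : (Finset.univ : Finset (Fin τ × Bool)).card = τ * 2 := by simp
  rw [hcard, Nat.log_mul_base (by norm_num) (by omega)] at h
  refine h.imp fun t hst ht g hg a ha σ => ?_
  rcases hg with rfl | ⟨a', ha', rfl⟩
  · exact ht (⟨a, ha⟩, σ) (Finset.mem_univ _)
  · exact monotone_signKnown _ hst (ho a' ha' a ha false σ)

theorem monotone_forall_lt {τ : ℕ} {P : ℕ → KState X → Prop} (h : ∀ a, Monotone (P a)) :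
    Monotone fun s => ∀ a < τ, P a s := fun _ _ hst hs a ha => h a hst (hs a ha)

theorem can_forall_lt {τ d : ℕ} {s : KState X} {P : ℕ → KState X → Prop}
    (hP : ∀ a, Monotone (P a)) (h : ∀ a < τ, Can s d (P a)) :
    Can s (τ * d) fun t => ∀ a < τ, P a t := by
  simpa using can_forall_finset (Finset.range τ) (fun a _ => hP a)
    fun a ha => h a (Finset.mem_range.1 ha)

/-- The cost is that of the boundary alone: `2τ` binary searches for the entering starts and `2τ`
evaluations of outgoing ones. The cells inside are decided by `statusIn_block` without any node of
the tree. -/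
theorem can_block {s : KState X} {τ c : ℕ} (hτ : 1 ≤ τ) {α β : ℕ → ℕ → X → ℝ}
    {E E' : ℕ → ℕ → Bool → X → ℝ}
    (hα : ∀ a b x, α (a + 1) b x = gridStep (β a b x) (α a b x) (E a b false x) (E a b true x))
    (hβ : ∀ a b x, β a (b + 1) x = gridStep (α a b x) (β a b x) (E' a b false x) (E' a b true x))
    (hE1 : ∀ a b x, E a b true x ≤ 1) (hE1' : ∀ a b x, E' a b true x ≤ 1)
    (h1 : Known 1 s) (hE : ∀ a b σ, Can s c (Known (E a b σ)))
    (hE' : ∀ a b σ, Can s c (Known (E' a b σ)))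
    (hα0 : ∀ b < τ, KnownStatus (α 0 b) s) (hβ0 : ∀ a < τ, KnownStatus (β a 0) s)
    (hEo : ∀ b < τ, ∀ a < τ, ∀ a' < τ, ∀ σ σ', SignKnown (fun x => E a b σ x - E a' b σ' x) s)
    (hEo' : ∀ a < τ, ∀ b < τ, ∀ b' < τ, ∀ σ σ',
      SignKnown (fun x => E' a b σ x - E' a b' σ' x) s) :
    Can s (2 * (τ * ((Nat.log 2 τ + 2) * (c + 3))) + 2 * (τ * (c + 1))) fun t =>
      (∀ b < τ, KnownStatus (α τ b) t) ∧ ∀ a < τ, KnownStatus (β a τ) t := by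
  have hmono : ∀ f : X → ℝ, ∀ E : ℕ → Bool → X → ℝ, Monotone fun t : KState X =>
      ∀ g ∈ lineStarts τ f E, ∀ a < τ, ∀ σ, SignKnown (fun x => g x - E a σ x) t :=
    fun f E t u htu ht g hg a ha σ => monotone_signKnown _ htu (ht g hg a ha σ)
  have rows := can_forall_lt (fun b => hmono (α 0 b) fun a => E a b)
    fun b hb => can_line hτ (hα0 b hb).1 (fun a σ => hE a b σ) (hEo b hb)
  have cols := can_forall_lt (fun a => hmono (β a 0) fun b => E' a b)
    fun a ha => can_line hτ (hβ0 a ha).1 (fun b σ => hE' a b σ) (hEo' a ha)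
  rw [two_mul, two_mul]
  refine (rows.and (monotone_forall_lt fun b => hmono _ _) cols).bind fun t hst ht => ?_
  obtain ⟨hr, hc⟩ := statusIn_block hα hβ hE1 hE1'
    (fun b hb => monotone_status _ hst (hα0 b hb).2)
    (fun a ha => monotone_status _ hst (hβ0 a ha).2) ht.1 ht.2
  refine Can.and (monotone_forall_lt fun b => monotone_knownStatus _) ?_ ?_
  · exact can_forall_lt (fun b => monotone_knownStatus _) fun b hb =>
      can_knownStatus_of_statusIn (monotone_known _ hst h1) (monotone_known _ hst (hα0 b hb).1)
        (fun a => (hE a b false).mono hst) (hr b hb)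
  · exact can_forall_lt (fun b => monotone_knownStatus _) fun a ha =>
      can_knownStatus_of_statusIn (monotone_known _ hst h1) (monotone_known _ hst (hβ0 a ha).1)
        (fun b => (hE' a b false).mono hst) (hc a ha)

/-- The `m × m` blocks are processed column by column, each from bottom to top. -/
theorem can_blocks {s : KState X} {τ c m : ℕ} (hτ : 1 ≤ τ) {α β : ℕ → ℕ → X → ℝ}
    {E E' : ℕ → ℕ → Bool → X → ℝ}
    (hα : ∀ a b x, α (a + 1) b x = gridStep (β a b x) (α a b x) (E a b false x) (E a b true x))
    (hβ : ∀ a b x, β a (b + 1) x = gridStep (α a b x) (β a b x) (E' a b false x) (E' a b true x))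
    (hE1 : ∀ a b x, E a b true x ≤ 1) (hE1' : ∀ a b x, E' a b true x ≤ 1)
    (h1 : Known 1 s) (hE : ∀ a b σ, Can s c (Known (E a b σ)))
    (hE' : ∀ a b σ, Can s c (Known (E' a b σ)))
    (hα0 : ∀ b, KnownStatus (α 0 b) s) (hβ0 : ∀ a, KnownStatus (β a 0) s)
    (hEo : ∀ k < m, ∀ b < m * τ, ∀ a < τ, ∀ a' < τ, ∀ σ σ',
      SignKnown (fun x => E (k * τ + a) b σ x - E (k * τ + a') b σ' x) s)
    (hEo' : ∀ k < m, ∀ a < m * τ, ∀ b < τ, ∀ b' < τ, ∀ σ σ',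
      SignKnown (fun x => E' a (k * τ + b) σ x - E' a (k * τ + b') σ' x) s) :
    Can s (m * (m * (2 * (τ * ((Nat.log 2 τ + 2) * (c + 3))) + 2 * (τ * (c + 1))))) fun t =>
      ∀ b < m * τ, KnownStatus (α (m * τ) b) t := by
  have hlt : ∀ k < m, ∀ a < τ, k * τ + a < m * τ := fun k hk a ha => by
    calc k * τ + a < k * τ + τ := by omega
      _ = (k + 1) * τ := by ring
      _ ≤ m * τ := Nat.mul_le_mul_right _ hk
  refine can_iterate (P := fun k t => ∀ b < m * τ, KnownStatus (α (k * τ) b) t) m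
    (can_of_monotone (monotone_forall_lt fun b => monotone_knownStatus _)
      (fun b _ => by simpa using hα0 b) 0) fun k hk t hst ht => ?_
  -- After `l` blocks of a column, the starts on its right boundary below height `l * τ` are
  -- available, and those on its horizontal cut at that height.
  refine (can_iterate (P := fun l u => (∀ b < l * τ, KnownStatus (α ((k + 1) * τ) b) u) ∧
    ∀ a < τ, KnownStatus (β (k * τ + a) (l * τ)) u) m (can_of_monotone ?_ ?_ 0) ?_).imp
    fun u _ hu => hu.1
  · exact fun u v huv hu => ⟨fun b hb => monotone_knownStatus _ huv (hu.1 b hb),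
      fun a ha => monotone_knownStatus _ huv (hu.2 a ha)⟩
  · exact ⟨by simp, fun a _ => by simpa using monotone_knownStatus _ hst (hβ0 (k * τ + a))⟩
  · rintro l hl u htu ⟨hu, hu'⟩
    have hsu := hst.trans htu
    refine (can_block (s := u) (τ := τ) (c := c) hτ (α := fun a b => α (k * τ + a) (l * τ + b))
      (β := fun a b => β (k * τ + a) (l * τ + b)) (E := fun a b => E (k * τ + a) (l * τ + b))
      (E' := fun a b => E' (k * τ + a) (l * τ + b)) (fun a b => hα _ _) (fun a b => hβ _ _)
      (fun a b => hE1 _ _) (fun a b => hE1' _ _) (monotone_known _ hsu h1)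
      (fun a b σ => (hE _ _ σ).mono hsu) (fun a b σ => (hE' _ _ σ).mono hsu)
      (fun b hb => monotone_knownStatus _ htu (ht _ (hlt l hl b hb))) (fun a ha => hu' a ha)
      (fun b hb a ha a' ha' σ σ' =>
        monotone_signKnown _ hsu (hEo k hk _ (hlt l hl b hb) a ha a' ha' σ σ'))
      (fun a ha b hb b' hb' σ σ' =>
        monotone_signKnown _ hsu (hEo' l hl _ (hlt k hk a ha) b hb b' hb' σ σ'))).imp ?_
    rintro v huv ⟨hv, hv'⟩
    refine ⟨fun b hb => ?_, fun a ha => ?_⟩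
    · rcases lt_or_ge b (l * τ) with h | h
      · exact monotone_knownStatus _ huv (hu b h)
      · obtain ⟨b, rfl⟩ := Nat.exists_eq_add_of_le h
        rw [add_mul, one_mul] at hb ⊢
        exact hv b (by omega)
    · rw [add_mul, one_mul]
      exact hv' a ha

/-- The cost of the whole grid. -/
theorem exists_can_grid : ∃ C e : ℕ, ∀ (X : Type) (s : KState X) (p q : ℕ → Fin 2 → X → ℝ)
    (α β : ℕ → ℕ → X → ℝ) (k m : ℕ),
    (∀ a b x, α (a + 1) b x = gridStep (β a b x) (α a b x)
      (freeEnd (fun i => p (a + 1) i x) (fun i => q b i x) (fun i => q (b + 1) i x) false)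
      (freeEnd (fun i => p (a + 1) i x) (fun i => q b i x) (fun i => q (b + 1) i x) true)) →
    (∀ a b x, β a (b + 1) x = gridStep (α a b x) (β a b x)
      (freeEnd (fun i => q (b + 1) i x) (fun i => p a i x) (fun i => p (a + 1) i x) false)
      (freeEnd (fun i => q (b + 1) i x) (fun i => p a i x) (fun i => p (a + 1) i x) true)) →
    Known 1 s → (∀ a i, Known (p a i) s) → (∀ b i, Known (q b i) s) →
    (∀ b, KnownStatus (α 0 b) s) → (∀ a, KnownStatus (β a 0) s) →
    Can s (C * (m * (2 ^ k) ^ e + m * m * 2 ^ k * (k + 1))) fun t =>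
      ∀ b < m * 2 ^ k, KnownStatus (α (m * 2 ^ k) b) t := by
  obtain ⟨c, e, hsort⟩ := exists_can_sort_freeEnds
  obtain ⟨c', hfree⟩ := exists_can_freeEnd
  refine ⟨4 * c + (4 * (c' + 3) + 2 * (c' + 1)), e, fun X s p q α β k m hα hβ h1 hp hq hα0 hβ0 => ?_⟩
  set τ := 2 ^ k with hτ
  have hτ1 : 1 ≤ τ := Nat.one_le_two_pow
  have : Nonempty (Fin τ) := ⟨⟨0, hτ1⟩⟩
  have hlog : Nat.log 2 τ = k := Nat.log_pow (by norm_num) k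
  -- the order on each line of cells
  have key : ∀ p q : ℕ → Fin 2 → X → ℝ, (∀ a i, Known (p a i) s) → (∀ b i, Known (q b i) s) →
      Can s (m * (c * τ ^ e) + m * (m * τ * (c * (k + 1)))) fun t => ∀ l < m, ∀ b < m * τ,
        ∀ a a' : Fin τ, ∀ σ σ', SignKnown (fun x =>
          freeEnd (fun i => p (l * τ + a + 1) i x) (fun i => q b i x) (fun i => q (b + 1) i x) σ -
          freeEnd (fun i => p (l * τ + a' + 1) i x) (fun i => q b i x) (fun i => q (b + 1) i x) σ')
            t := by
    intro p q hp hq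
    -- Each of the `m` groups of `τ` vertices is prepared once, at cost `c * τ ^ e`. Then each of
    -- the `m * τ` segments is queried against every group.
    refine (can_forall_lt (fun l => monotone_answers _ _) fun l _ => by
      simpa using hsort X (Fin τ) s (fun a => p (l * τ + a + 1)) h1 fun a i => hp _ _).bind ?_
    intro t hst ht
    refine can_forall_lt (fun l u v huv hu b hb a a' σ σ' =>
      monotone_signKnown _ huv (hu b hb a a' σ σ')) fun l hl => ?_
    refine can_forall_lt (fun b u v huv hu a a' σ σ' =>
      monotone_signKnown _ huv (hu a a' σ σ')) fun b _ => ?_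
    have := ht l hl (fun i => if i.1 = 0 then q b i.2 else q (b + 1) i.2) t le_rfl ?_
    · simpa [hlog] using this
    · rintro ⟨i, j⟩
      fin_cases i
      · exact monotone_known _ hst (hq _ _)
      · exact monotone_known _ hst (hq _ _)
  have hcost : (m * (c * τ ^ e) + m * (m * τ * (c * (k + 1)))) +
      (m * (c * τ ^ e) + m * (m * τ * (c * (k + 1)))) +
      m * (m * (2 * (τ * ((Nat.log 2 τ + 2) * (c' + 3))) + 2 * (τ * (c' + 1)))) ≤
      (4 * c + (4 * (c' + 3) + 2 * (c' + 1))) * (m * τ ^ e + m * m * τ * (k + 1)) := by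
    rw [hlog]
    have h2 : m * m * τ * (k + 2) ≤ m * m * τ * (2 * (k + 1)) := Nat.mul_le_mul_left _ (by omega)
    have h3 : m * m * τ * 1 ≤ m * m * τ * (k + 1) := Nat.mul_le_mul_left _ (by omega)
    have h4 := Nat.mul_le_mul_right (2 * (c' + 3)) h2
    have h5 := Nat.mul_le_mul_right (2 * (c' + 1)) h3
    have h6 := Nat.zero_le ((2 * c + (4 * (c' + 3) + 2 * (c' + 1))) * (m * τ ^ e))
    have h7 := Nat.zero_le (2 * c * (m * m * τ * (k + 1)))
    generalize τ ^ e = T at *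
    nlinarith
  refine (((key p q hp hq).and ?_ (key q p hq hp)).bind fun t hst ht => ?_).mono_depth hcost
  · exact fun u v huv hu l hl b hb a a' σ σ' => monotone_signKnown _ huv (hu l hl b hb a a' σ σ')
  · refine can_blocks hτ1 hα hβ (E := fun a b σ x => freeEnd (fun i => p (a + 1) i x)
      (fun i => q b i x) (fun i => q (b + 1) i x) σ) (E' := fun a b σ x =>
      freeEnd (fun i => q (b + 1) i x) (fun i => p a i x) (fun i => p (a + 1) i x) σ)
      (fun _ _ _ => freeEnd_true_le_one _ _ _) (fun _ _ _ => freeEnd_true_le_one _ _ _)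
      (monotone_known _ hst h1) ?_ ?_ (fun b => monotone_knownStatus _ hst (hα0 b))
      (fun a => monotone_knownStatus _ hst (hβ0 a)) ?_ ?_
    · exact fun a b σ => (hfree X s _ _ _ h1 (fun i => hp _ i) (fun i => hq _ i)
        (fun i => hq _ i) σ).mono hst
    · exact fun a b σ => (hfree X s _ _ _ h1 (fun i => hq _ i) (fun i => hp _ i)
        (fun i => hp _ i) σ).mono hst
    · exact fun l hl b hb a ha a' ha' σ σ' => ht.1 l hl b hb ⟨a, ha⟩ ⟨a', ha'⟩ σ σ'
    · exact fun l hl a ha b hb b' hb' σ σ' => ht.2 l hl a ha ⟨b, hb⟩ ⟨b', hb'⟩ σ σ'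

end KState

/-! ### Curves, the free space and the recursion for reachable starts -/

open Topology

/-- The polygonal curve through infinitely many vertices. -/
noncomputable def seqCurve (p : ℕ → Plane) (t : ℝ) : Plane :=
  (1 - Int.fract t) • p ⌊t⌋₊ + Int.fract t • p (⌊t⌋₊ + 1)

/-- A finite sequence of vertices, with the last one repeated. -/
def clampSeq {n : ℕ} (p : Fin (n + 1) → Plane) (i : ℕ) : Plane :=
  p ⟨min i n, Nat.lt_succ_of_le (min_le_right _ _)⟩

theorem polyCurve_eq_seqCurve {n : ℕ} (p : Fin (n + 1) → Plane) :
    polyCurve p = seqCurve (clampSeq p) := rfl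

theorem seqCurve_natCast_add (p : ℕ → Plane) (i : ℕ) {t : ℝ} (h0 : 0 ≤ t) (h1 : t ≤ 1) :
    seqCurve p (i + t) = (1 - t) • p i + t • p (i + 1) := by
  rcases h1.lt_or_eq with h1 | rfl
  · have hf : ⌊(i : ℝ) + t⌋₊ = i := by
      rw [Nat.floor_eq_iff (by positivity)]
      constructor <;> linarith
    have hfr : Int.fract ((i : ℝ) + t) = t := by
      rw [Int.fract_natCast_add, Int.fract_eq_self.2 ⟨h0, h1⟩]
    rw [seqCurve, hf, hfr]
  · have hf : ⌊(i : ℝ) + 1⌋₊ = i + 1 := by exact_mod_cast Nat.floor_natCast (R := ℝ) (i + 1)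
    have hfr : Int.fract ((i : ℝ) + 1) = 0 := by simp
    rw [seqCurve, hf, hfr]
    simp

theorem seqCurve_natCast (p : ℕ → Plane) (i : ℕ) : seqCurve p i = p i := by
  simpa using seqCurve_natCast_add p i le_rfl zero_le_one

theorem continuousOn_seqCurve (p : ℕ → Plane) (N : ℕ) :
    ContinuousOn (seqCurve p) (Icc (0 : ℝ) N) := by
  induction N with
  | zero => simp
  | succ N ih =>
    have h : ContinuousOn (seqCurve p) (Icc (N : ℝ) (N + 1)) := by
      have : ContinuousOn (fun t : ℝ => (1 - (t - N)) • p N + (t - N) • p (N + 1))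
          (Icc (N : ℝ) (N + 1)) := by fun_prop
      refine this.congr fun t ht => ?_
      have := seqCurve_natCast_add p N (t := t - N) (by linarith [ht.1]) (by linarith [ht.2])
      rwa [add_sub_cancel] at this
    rw [Nat.cast_succ, ← Icc_union_Icc_eq_Icc (Nat.cast_nonneg N) (by linarith : (N : ℝ) ≤ N + 1)]
    exact ih.union_of_isClosed h isClosed_Icc isClosed_Icc

theorem seqCurve_clampSeq_of_le {n : ℕ} (p : Fin (n + 1) → Plane) {t : ℝ} (h : (n : ℝ) ≤ t) :
    seqCurve (clampSeq p) t = p (Fin.last n) := by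
  have hf : n ≤ ⌊t⌋₊ := Nat.le_floor h
  have h1 : ∀ i, n ≤ i → clampSeq p i = p (Fin.last n) := fun i hi => by
    simp [clampSeq, hi, Fin.last]
  rw [seqCurve, h1 _ hf, h1 _ (by omega), ← add_smul]
  simp

theorem seqCurve_clampSeq_min {n : ℕ} (p : Fin (n + 1) → Plane) (t : ℝ) :
    seqCurve (clampSeq p) (min t n) = seqCurve (clampSeq p) t := by
  rcases le_total t n with h | h
  · rw [min_eq_left h]
  · rw [min_eq_right h, seqCurve_clampSeq_of_le p h, seqCurve_clampSeq_of_le p le_rfl]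

theorem norm_sub_le_one_iff (p q : Plane) : ‖p - q‖ ≤ 1 ↔ offsetSq p q ≤ 0 := by
  rw [EuclideanSpace.norm_eq, Real.sqrt_le_iff, Fin.sum_univ_two]
  simp only [Real.norm_eq_abs, PiLp.sub_apply, offsetSq, zero_le_one, true_and, sub_nonpos,
    pow_two, abs_mul_abs_self, mul_one]

theorem norm_sub_segment_le_one_iff (p q q' : Plane) {t : ℝ} (h0 : 0 ≤ t) (h1 : t ≤ 1) :
    ‖p - ((1 - t) • q + t • q')‖ ≤ 1 ↔
      freeEnd p q q' false ≤ t ∧ t ≤ freeEnd p q q' true := by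
  rw [← quadratic_nonpos_iff_freeEnd p q q' h0 h1, norm_sub_le_one_iff]
  simp only [offsetSq, edgeSq, edgeDot, PiLp.add_apply, PiLp.smul_apply, smul_eq_mul]
  ring_nf

section Grid

variable (P Q : ℕ → Plane)

/-- The starting points of the reachable parts of the left and of the lower side of the cells of
the free space diagram, relative to the lower left corner. -/
noncomputable def gridStart (P Q : ℕ → Plane) : ℕ → ℕ → ℝ × ℝ
  | 0, 0 => if offsetSq (P 0) (Q 0) ≤ 0 then (0, 0) else (2, 2)
  | i + 1, 0 => (gridStep (gridStart P Q i 0).2 (gridStart P Q i 0).1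
      (freeEnd (P (i + 1)) (Q 0) (Q 1) false) (freeEnd (P (i + 1)) (Q 0) (Q 1) true), 2)
  | 0, j + 1 => (2, gridStep (gridStart P Q 0 j).1 (gridStart P Q 0 j).2
      (freeEnd (Q (j + 1)) (P 0) (P 1) false) (freeEnd (Q (j + 1)) (P 0) (P 1) true))
  | i + 1, j + 1 => (gridStep (gridStart P Q i (j + 1)).2 (gridStart P Q i (j + 1)).1
      (freeEnd (P (i + 1)) (Q (j + 1)) (Q (j + 2)) false)
      (freeEnd (P (i + 1)) (Q (j + 1)) (Q (j + 2)) true),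
      gridStep (gridStart P Q (i + 1) j).1 (gridStart P Q (i + 1) j).2
      (freeEnd (Q (j + 1)) (P (i + 1)) (P (i + 2)) false)
      (freeEnd (Q (j + 1)) (P (i + 1)) (P (i + 2)) true))
termination_by i j => i + j

/-- The starting point of the reachable part of the left side of a cell. -/
noncomputable def leftStart (i j : ℕ) : ℝ := (gridStart P Q i j).1

/-- The starting point of the reachable part of the lower side of a cell. -/
noncomputable def lowerStart (i j : ℕ) : ℝ := (gridStart P Q i j).2

theorem leftStart_succ (i j : ℕ) : leftStart P Q (i + 1) j =
    gridStep (lowerStart P Q i j) (leftStart P Q i j)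
      (freeEnd (P (i + 1)) (Q j) (Q (j + 1)) false)
      (freeEnd (P (i + 1)) (Q j) (Q (j + 1)) true) := by
  cases j <;> rw [leftStart, gridStart] <;> rfl

theorem lowerStart_succ (i j : ℕ) : lowerStart P Q i (j + 1) =
    gridStep (leftStart P Q i j) (lowerStart P Q i j)
      (freeEnd (Q (j + 1)) (P i) (P (i + 1)) false)
      (freeEnd (Q (j + 1)) (P i) (P (i + 1)) true) := by
  cases i <;> rw [lowerStart, gridStart] <;> rfl

theorem leftStart_zero_zero :
    leftStart P Q 0 0 = if offsetSq (P 0) (Q 0) ≤ 0 then 0 else 2 := by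
  rw [leftStart, gridStart]
  split_ifs <;> rfl

theorem lowerStart_zero_zero :
    lowerStart P Q 0 0 = if offsetSq (P 0) (Q 0) ≤ 0 then 0 else 2 := by
  rw [lowerStart, gridStart]
  split_ifs <;> rfl

/-- Declaring the outer boundary empty loses nothing: a path along it enters the next cell at a
corner, and that corner belongs to the lower side of this cell. -/
theorem leftStart_zero_succ (j : ℕ) : leftStart P Q 0 (j + 1) = 2 := by
  rw [leftStart, gridStart]

theorem lowerStart_succ_zero (i : ℕ) : lowerStart P Q (i + 1) 0 = 2 := by
  rw [lowerStart, gridStart]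

end Grid

theorem gridStep_le {b a l r t : ℝ} (h : b ≤ 1 ∨ a ≤ t) (hl : l ≤ t) (hr : t ≤ r) :
    gridStep b a l r ≤ t := by
  unfold gridStep
  by_cases hb : b ≤ 1
  · simp [hb, hl.trans hr, hl]
  · have ha := h.resolve_left hb
    simp [hb, ha.trans hr, hl.trans hr, ha, hl]

theorem gridStep_le_one {b a l r : ℝ} (hr : r ≤ 1) (h : gridStep b a l r ≤ 1) :
    (b ≤ 1 ∧ gridStep b a l r = l ∧ l ≤ r) ∨
      (a ≤ 1 ∧ gridStep b a l r = max a l ∧ max a l ≤ r) := by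
  unfold gridStep at h ⊢
  by_cases hb : b ≤ 1
  · simp only [hb, if_true] at h ⊢
    by_cases hl : l ≤ r
    · simp [hl]
    · simp only [hl, if_false] at h
      norm_num at h
  · simp only [hb, if_false] at h ⊢
    by_cases hl : max a l ≤ r
    · simp only [hl, if_true]
      exact .inr ⟨(le_max_left _ _).trans (hl.trans hr), trivial, trivial⟩
    · simp only [hl, if_false] at h
      norm_num at h

/-! ### Monotone paths in the free space -/

/-- The free space. -/
def IsFree (P Q : ℕ → Plane) (x y : ℝ) : Prop := ‖seqCurve P x - seqCurve Q y‖ ≤ 1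

/-- There is a monotone path in the free space. -/
def MonoConn (P Q : ℕ → Plane) (z w : ℝ × ℝ) : Prop :=
  ∃ (T : ℝ) (a b : ℝ → ℝ), 0 ≤ T ∧ Continuous a ∧ Continuous b ∧ Monotone a ∧ Monotone b ∧
    (∀ s ≤ 0, a s = z.1 ∧ b s = z.2) ∧ (∀ s, T ≤ s → a s = w.1 ∧ b s = w.2) ∧
    ∀ s, IsFree P Q (a s) (b s)

section Conn

variable {P Q : ℕ → Plane}

theorem MonoConn.refl {z : ℝ × ℝ} (h : IsFree P Q z.1 z.2) : MonoConn P Q z z :=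
  ⟨0, fun _ => z.1, fun _ => z.2, le_rfl, continuous_const, continuous_const, monotone_const,
    monotone_const, by simp, by simp, fun _ => h⟩

theorem MonoConn.trans {u v w : ℝ × ℝ} (h : MonoConn P Q u v) (h' : MonoConn P Q v w) :
    MonoConn P Q u w := by
  obtain ⟨T, a, b, hT, ha, hb, ma, mb, h0, h1, hf⟩ := h
  obtain ⟨T', a', b', hT', ha', hb', ma', mb', h0', h1', hf'⟩ := h'
  -- Concatenation by adding increments makes continuity and monotonicity immediate; one of the two
  -- summands is always at rest.
  refine ⟨T + T', fun s => a s + (a' (s - T) - v.1), fun s => b s + (b' (s - T) - v.2),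
    by positivity, by fun_prop, by fun_prop, ?_, ?_, ?_, ?_, ?_⟩
  · exact fun s t hst => add_le_add (ma hst) (sub_le_sub_right (ma' (by linarith)) _)
  · exact fun s t hst => add_le_add (mb hst) (sub_le_sub_right (mb' (by linarith)) _)
  · intro s hs
    simp [h0 s hs, h0' (s - T) (by linarith)]
  · intro s hs
    simp [h1 s (by linarith), h1' (s - T) (by linarith)]
  · intro s
    rcases le_total s T with hs | hs
    · simpa [h0' (s - T) (by linarith)] using hf s
    · simpa [h1 s hs] using hf' (s - T)

/-- On a cell `P x - Q y` is affine in `(x, y)`, so the free part of the cell, a preimage of the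
unit ball, is convex, and the straight segment is a path. -/
theorem MonoConn.of_cell (i j : ℕ) {x y x' y' : ℝ} (hx : 0 ≤ x) (hxx : x ≤ x') (hx' : x' ≤ 1)
    (hy : 0 ≤ y) (hyy : y ≤ y') (hy' : y' ≤ 1) (h : IsFree P Q (i + x) (j + y))
    (h' : IsFree P Q (i + x') (j + y')) : MonoConn P Q (i + x, j + y) (i + x', j + y') := by
  set c : ℝ → ℝ := fun s => max 0 (min s 1) with hc
  have hc0 : ∀ s, 0 ≤ c s := fun s => le_max_left _ _
  have hc1 : ∀ s, c s ≤ 1 := fun s => max_le zero_le_one (min_le_right _ _)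
  have hcm : Monotone c := fun s t hst => max_le_max le_rfl (min_le_min hst le_rfl)
  have hcc : Continuous c := by fun_prop
  refine ⟨1, fun s => i + (x + c s * (x' - x)), fun s => j + (y + c s * (y' - y)), zero_le_one,
    by fun_prop, by fun_prop, ?_, ?_, ?_, ?_, ?_⟩
  · intro s t hst
    have := mul_le_mul_of_nonneg_right (hcm hst) (sub_nonneg.2 hxx)
    simp only
    linarith
  · intro s t hst
    have := mul_le_mul_of_nonneg_right (hcm hst) (sub_nonneg.2 hyy)
    simp only
    linarith
  · intro s hs
    have : c s = 0 := by simp [hc, hs]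
    simp [this]
  · intro s hs
    have : c s = 1 := by simp [hc, hs]
    simp [this]
  · intro s
    have e1 : 0 ≤ c s * (x' - x) := mul_nonneg (hc0 s) (sub_nonneg.2 hxx)
    have e2 : c s * (x' - x) ≤ x' - x := mul_le_of_le_one_left (sub_nonneg.2 hxx) (hc1 s)
    have e3 : 0 ≤ c s * (y' - y) := mul_nonneg (hc0 s) (sub_nonneg.2 hyy)
    have e4 : c s * (y' - y) ≤ y' - y := mul_le_of_le_one_left (sub_nonneg.2 hyy) (hc1 s)
    unfold IsFree at *
    rw [seqCurve_natCast_add P i hx (by linarith), seqCurve_natCast_add Q j hy (by linarith)] at h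
    rw [seqCurve_natCast_add P i (by linarith) hx',
      seqCurve_natCast_add Q j (by linarith) hy'] at h'
    rw [seqCurve_natCast_add P i (by linarith) (by linarith),
      seqCurve_natCast_add Q j (by linarith) (by linarith)]
    have := (convex_closedBall (0 : Plane) 1) (mem_closedBall_zero_iff.2 h)
      (mem_closedBall_zero_iff.2 h') (sub_nonneg.2 (hc1 s)) (hc0 s) (by ring)
    rw [mem_closedBall_zero_iff] at this
    refine le_of_eq_of_le (congrArg norm ?_) this
    module

theorem isFree_left_iff (i j : ℕ) {t : ℝ} (h0 : 0 ≤ t) (h1 : t ≤ 1) : IsFree P Q i (j + t) ↔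
    freeEnd (P i) (Q j) (Q (j + 1)) false ≤ t ∧ t ≤ freeEnd (P i) (Q j) (Q (j + 1)) true := by
  rw [← norm_sub_segment_le_one_iff _ _ _ h0 h1, IsFree, seqCurve_natCast,
    seqCurve_natCast_add Q j h0 h1]

theorem isFree_lower_iff (i j : ℕ) {t : ℝ} (h0 : 0 ≤ t) (h1 : t ≤ 1) : IsFree P Q (i + t) j ↔
    freeEnd (Q j) (P i) (P (i + 1)) false ≤ t ∧ t ≤ freeEnd (Q j) (P i) (P (i + 1)) true := by
  rw [← norm_sub_segment_le_one_iff _ _ _ h0 h1, IsFree, seqCurve_natCast,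
    seqCurve_natCast_add P i h0 h1, norm_sub_rev]

/-- Soundness of the recursion: whenever a start is not `2`, one of the two entrance sides has a
start that is already connected to the origin, and a straight segment in the cell leads from there
to the new start. -/
theorem monoConn_gridStart (n : ℕ) : ∀ i j, i + j = n →
    (leftStart P Q i j ≤ 1 → 0 ≤ leftStart P Q i j ∧
      MonoConn P Q (0, 0) (i, j + leftStart P Q i j) ∧ IsFree P Q i (j + leftStart P Q i j)) ∧
    (lowerStart P Q i j ≤ 1 → 0 ≤ lowerStart P Q i j ∧
      MonoConn P Q (0, 0) (i + lowerStart P Q i j, j) ∧ IsFree P Q (i + lowerStart P Q i j) j) := by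
  induction n using Nat.strong_induction_on with
  | _ n ih =>
  intro i j hij
  have base : offsetSq (P 0) (Q 0) ≤ 0 → IsFree P Q 0 0 := fun h => by
    have h0 := seqCurve_natCast P 0
    have h0' := seqCurve_natCast Q 0
    rw [Nat.cast_zero] at h0 h0'
    rwa [IsFree, h0, h0', norm_sub_le_one_iff]
  constructor
  · cases i with
    | zero =>
      cases j with
      | zero =>
        rw [leftStart_zero_zero]
        split_ifs with h
        · intro _
          simpa using ⟨MonoConn.refl (z := (0, 0)) (base h), base h⟩
        · intro h'
          norm_num at h'
      | succ j =>
        intro h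
        rw [leftStart_zero_succ] at h
        norm_num at h
    | succ i =>
      intro h
      obtain ⟨iha, ihb⟩ := ih (i + j) (by omega) i j rfl
      have hl0 := freeEnd_false_nonneg (P (i + 1)) (Q j) (Q (j + 1))
      have hr1 := freeEnd_true_le_one (P (i + 1)) (Q j) (Q (j + 1))
      rw [leftStart_succ] at h ⊢
      rcases gridStep_le_one hr1 h with ⟨hb, he, hlr⟩ | ⟨ha, he, hlr⟩
      · rw [he]
        obtain ⟨hb0, hconn, hfree⟩ := ihb hb
        have hf := (isFree_left_iff (P := P) (Q := Q) (i + 1) j hl0 (hlr.trans hr1)).2 ⟨le_rfl, hlr⟩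
        refine ⟨hl0, hconn.trans ?_, hf⟩
        have := MonoConn.of_cell (P := P) (Q := Q) i j hb0 hb le_rfl le_rfl hl0 (hlr.trans hr1)
          (by simpa using hfree) (by simpa using hf)
        simpa using this
      · rw [he]
        obtain ⟨ha0, hconn, hfree⟩ := iha ha
        have hm0 := ha0.trans (le_max_left _ (freeEnd (P (i + 1)) (Q j) (Q (j + 1)) false))
        have hf := (isFree_left_iff (P := P) (Q := Q) (i + 1) j hm0 (hlr.trans hr1)).2
          ⟨le_max_right _ _, hlr⟩
        refine ⟨hm0, hconn.trans ?_, hf⟩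
        have := MonoConn.of_cell (P := P) (Q := Q) i j le_rfl zero_le_one le_rfl ha0
          (le_max_left _ _) (hlr.trans hr1) (by simpa using hfree) (by simpa using hf)
        simpa using this
  · cases j with
    | zero =>
      cases i with
      | zero =>
        rw [lowerStart_zero_zero]
        split_ifs with h
        · intro _
          simpa using ⟨MonoConn.refl (z := (0, 0)) (base h), base h⟩
        · intro h'
          norm_num at h'
      | succ i =>
        intro h
        rw [lowerStart_succ_zero] at h
        norm_num at h
    | succ j =>
      intro h
      obtain ⟨iha, ihb⟩ := ih (i + j) (by omega) i j rfl
      have hl0 := freeEnd_false_nonneg (Q (j + 1)) (P i) (P (i + 1))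
      have hr1 := freeEnd_true_le_one (Q (j + 1)) (P i) (P (i + 1))
      rw [lowerStart_succ] at h ⊢
      rcases gridStep_le_one hr1 h with ⟨hb, he, hlr⟩ | ⟨ha, he, hlr⟩
      · rw [he]
        obtain ⟨hb0, hconn, hfree⟩ := iha hb
        have hf := (isFree_lower_iff (P := P) (Q := Q) i (j + 1) hl0 (hlr.trans hr1)).2
          ⟨le_rfl, hlr⟩
        refine ⟨hl0, hconn.trans ?_, hf⟩
        have := MonoConn.of_cell (P := P) (Q := Q) i j le_rfl hl0 (hlr.trans hr1) hb0 hb le_rfl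
          (by simpa using hfree) (by simpa using hf)
        simpa using this
      · rw [he]
        obtain ⟨ha0, hconn, hfree⟩ := ihb ha
        have hm0 := ha0.trans (le_max_left _ (freeEnd (Q (j + 1)) (P i) (P (i + 1)) false))
        have hf := (isFree_lower_iff (P := P) (Q := Q) i (j + 1) hm0 (hlr.trans hr1)).2
          ⟨le_max_right _ _, hlr⟩
        refine ⟨hm0, hconn.trans ?_, hf⟩
        have := MonoConn.of_cell (P := P) (Q := Q) i j ha0 (le_max_left _ _) (hlr.trans hr1) le_rfl
          zero_le_one le_rfl (by simpa using hfree) (by simpa using hf)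
        simpa using this

end Conn

/-! ### From monotone paths to reparametrizations -/

theorem exists_isGreatest_norm_sub {n : ℕ} (p q : Fin (n + 1) → Plane) {σ : ℝ → ℝ}
    (hσ : IsReparam n σ) : ∃ r, IsGreatest
      ((fun x : ℝ => ‖polyCurve p x - polyCurve q (σ x)‖) '' Icc (0 : ℝ) n) r := by
  have hn : (0 : ℝ) ≤ n := Nat.cast_nonneg n
  have hmaps : MapsTo σ (Icc (0 : ℝ) n) (Icc (0 : ℝ) n) := fun x hx =>
    ⟨hσ.2.2.1 ▸ hσ.2.1 (left_mem_Icc.2 hn) hx hx.1,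
      (hσ.2.1 hx (right_mem_Icc.2 hn) hx.2).trans_eq hσ.2.2.2⟩
  simp only [polyCurve_eq_seqCurve]
  refine (isCompact_Icc.image_of_continuousOn ?_).exists_isGreatest ((nonempty_Icc.2 hn).image _)
  exact ((continuousOn_seqCurve _ n).sub ((continuousOn_seqCurve _ n).comp hσ.1 hmaps)).norm

theorem frechetDist_le_of_isReparam {n : ℕ} (p q : Fin (n + 1) → Plane) {σ : ℝ → ℝ}
    (hσ : IsReparam n σ) {c : ℝ}
    (h : ∀ x ∈ Icc (0 : ℝ) n, ‖polyCurve p x - polyCurve q (σ x)‖ ≤ c) : frechetDist p q ≤ c := by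
  obtain ⟨r, hr⟩ := exists_isGreatest_norm_sub p q hσ
  unfold frechetDist
  refine (csInf_le ⟨0, ?_⟩ (by exact ⟨σ, hσ, hr⟩)).trans ?_
  · rintro r ⟨σ, -, ⟨x, -, rfl⟩, -⟩
    exact norm_nonneg _
  · obtain ⟨x, hx, rfl⟩ := hr.1
    exact h x hx

theorem exists_isReparam_of_frechetDist_lt {n : ℕ} (p q : Fin (n + 1) → Plane) {c : ℝ}
    (h : frechetDist p q < c) : ∃ σ : ℝ → ℝ, IsReparam n σ ∧
      ∀ x ∈ Icc (0 : ℝ) n, ‖polyCurve p x - polyCurve q (σ x)‖ ≤ c := by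
  have hid : IsReparam n id := ⟨continuousOn_id, monotoneOn_id, rfl, rfl⟩
  obtain ⟨r₀, hr₀⟩ := exists_isGreatest_norm_sub p q hid
  unfold frechetDist at h
  obtain ⟨r, ⟨σ, hσ, hr⟩, hrc⟩ := exists_lt_of_csInf_lt (by exact ⟨r₀, id, hid, hr₀⟩) h
  exact ⟨σ, hσ, fun x hx => (hr.2 ⟨x, hx, rfl⟩).trans hrc.le⟩

/-- Where `a` is constant, the path is vertical and is no graph over the first axis. Replacing `a`
by the strictly increasing `A = (1 - η) a + m s` yields the reparametrization `b ∘ A⁻¹`. By uniform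
continuity of the first curve this costs only `ε`, which the infimum absorbs. -/
theorem frechetDist_le_one_of_path {n : ℕ} (hn : 1 ≤ n) (p q : Fin (n + 1) → Plane) {T : ℝ}
    {a b : ℝ → ℝ} (hT : 0 < T) (ha : Continuous a) (hb : Continuous b) (ma : Monotone a)
    (mb : Monotone b) (a0 : ∀ s ≤ 0, a s = 0) (b0 : b 0 = 0) (aT : ∀ s, T ≤ s → a s = n)
    (bT : b T = n) (hf : ∀ s, ‖polyCurve p (a s) - polyCurve q (b s)‖ ≤ 1) :
    frechetDist p q ≤ 1 := by
  have hn0 : (0 : ℝ) < n := by exact_mod_cast hn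
  have ha0 : ∀ s, 0 ≤ a s := fun s => (a0 _ (min_le_right s 0)) ▸ ma (min_le_left s 0)
  have han : ∀ s, a s ≤ n := fun s => (aT _ (le_max_right s T)) ▸ ma (le_max_left s T)
  refine le_of_forall_pos_le_add fun ε hε => ?_
  obtain ⟨δ, hδ, hunif⟩ := Metric.uniformContinuousOn_iff.1
    (isCompact_Icc.uniformContinuousOn_of_continuous (continuousOn_seqCurve (clampSeq p) n)) ε hε
  obtain ⟨η, hη0, hη1, hηδ⟩ : ∃ η : ℝ, 0 < η ∧ η < 1 ∧ η * n < δ := by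
    refine ⟨min (1 / 2) (δ / (2 * n)), by positivity, (min_le_left _ _).trans_lt (by norm_num), ?_⟩
    calc min (1 / 2) (δ / (2 * n)) * n ≤ δ / (2 * n) * n :=
          mul_le_mul_of_nonneg_right (min_le_right _ _) hn0.le
      _ = δ / 2 := by field_simp
      _ < δ := by linarith
  -- With this slope `A` still runs from `0` at `0` to `n` at `T`.
  set m : ℝ := η * n / T with hm
  have hm0 : 0 < m := by positivity
  set A : ℝ → ℝ := fun s => (1 - η) * a s + m * s with hA
  have hAmono : StrictMono A := fun s t hst => add_lt_add_of_le_of_lt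
    (mul_le_mul_of_nonneg_left (ma hst.le) (by linarith)) (mul_lt_mul_of_pos_left hst hm0)
  have hAcont : Continuous A := by fun_prop
  have hAsurj : Function.Surjective A := by
    refine hAcont.surjective ?_ ?_
    · refine tendsto_atTop_mono (fun s => ?_) (tendsto_id.const_mul_atTop hm0)
      have := mul_nonneg (by linarith : 0 ≤ 1 - η) (ha0 s)
      simp only [hA, id]
      linarith
    · refine tendsto_atBot_mono (fun s => ?_)
        (tendsto_atBot_add_const_left atBot ((1 - η) * n) (tendsto_id.const_mul_atBot hm0))
      have := mul_le_mul_of_nonneg_left (han s) (by linarith : 0 ≤ 1 - η)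
      simp only [hA, id]
      linarith
  set e := hAmono.orderIsoOfSurjective A hAsurj with he
  have heA : ∀ s, e s = A s := fun s => rfl
  have hA0 : A 0 = 0 := by simp [hA, a0 0 le_rfl]
  have hAT : A T = n := by
    simp only [hA, aT T le_rfl, hm]
    field_simp
    ring
  have he0 : e.symm 0 = 0 := by rw [OrderIso.symm_apply_eq, heA, hA0]
  have hen : e.symm n = T := by rw [OrderIso.symm_apply_eq, heA, hAT]
  have hσ : IsReparam n (b ∘ e.symm) :=
    ⟨(hb.comp e.symm.continuous).continuousOn, (mb.comp e.symm.monotone).monotoneOn _,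
      by simp [he0, b0], by simp [hen, bT]⟩
  refine frechetDist_le_of_isReparam p q hσ fun x hx => ?_
  obtain ⟨s, rfl⟩ := hAsurj x
  have hs : e.symm (A s) = s := by rw [OrderIso.symm_apply_eq, heA]
  have hs0 : 0 ≤ s := hAmono.le_iff_le.1 (hA0.trans_le hx.1)
  have hsT : s ≤ T := hAmono.le_iff_le.1 (hx.2.trans_eq hAT.symm)
  rw [Function.comp_apply, hs]
  have hdist : dist (A s) (a s) < δ := by
    have h1 : A s - a s = η * (n * (s / T) - a s) := by
      simp only [hA, hm]
      ring
    have h2 : s / T ≤ 1 := (div_le_one hT).2 hsT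
    have h3 : 0 ≤ s / T := by positivity
    have h4 : |n * (s / T) - a s| ≤ n := by
      rw [abs_le]
      constructor <;> nlinarith [ha0 s, han s]
    rw [Real.dist_eq, h1, abs_mul, abs_of_pos hη0]
    exact (mul_le_mul_of_nonneg_left h4 hη0.le).trans_lt hηδ
  have h5 := hunif (A s) hx (a s) ⟨ha0 s, han s⟩ hdist
  rw [dist_eq_norm] at h5
  calc ‖polyCurve p (A s) - polyCurve q (b s)‖
      = ‖(polyCurve p (a s) - polyCurve q (b s)) + (polyCurve p (A s) - polyCurve p (a s))‖ := by
        congr 1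
        abel
    _ ≤ 1 + ε := (norm_add_le _ _).trans (add_le_add (hf s) h5.le)

/-- Beyond the parameter `n` both padded curves rest at their last vertices, so the coordinates of
the path may be cut off at `n`. The case `n = 0` is separate because tilting needs positive length.
-/
theorem frechetDist_le_one_of_monoConn {n N : ℕ} (hnN : n ≤ N) (hN : 1 ≤ N)
    (p q : Fin (n + 1) → Plane)
    (h : MonoConn (clampSeq p) (clampSeq q) (0, 0) (N, N)) : frechetDist p q ≤ 1 := by
  obtain ⟨T, a, b, hT, ha, hb, ma, mb, h0, hTN, hf⟩ := h
  rcases Nat.eq_zero_or_pos n with rfl | hn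
  · refine frechetDist_le_of_isReparam p q (σ := id) ⟨continuousOn_id, monotoneOn_id, rfl, by simp⟩ ?_
    intro x hx
    have : x = 0 := le_antisymm (by simpa using hx.2) hx.1
    have h2 := hf 0
    rw [(h0 0 le_rfl).1, (h0 0 le_rfl).2] at h2
    rw [this]
    exact h2
  · have hT' : 0 < T := by
      refine lt_of_le_of_ne hT fun hT => ?_
      have h1 : (N : ℝ) = 0 := (hTN 0 hT.symm.le).1.symm.trans (h0 0 le_rfl).1
      have : N = 0 := by exact_mod_cast h1
      omega
    have hnN' : (n : ℝ) ≤ N := by exact_mod_cast hnN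
    refine frechetDist_le_one_of_path hn p q (a := fun s => min (a s) n) (b := fun s => min (b s) n)
      hT' (by fun_prop) (by fun_prop) (ma.min monotone_const) (mb.min monotone_const) ?_ ?_ ?_ ?_ ?_
    · intro s hs
      simp [(h0 s hs).1]
    · simp [(h0 0 le_rfl).2]
    · intro s hs
      simp [(hTN s hs).1, hnN']
    · simp [(hTN T le_rfl).2, hnN']
    · intro s
      rw [polyCurve_eq_seqCurve, polyCurve_eq_seqCurve, seqCurve_clampSeq_min,
        seqCurve_clampSeq_min]
      exact hf s

/-! ### From reparametrizations to the grid -/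

/-- The heights `y i` at which a monotone path in the free space of level `ρ` passes the vertical
lines of the grid, and the abscissae `x j` at which it passes the horizontal ones. -/
structure IsCrossing (P Q : ℕ → Plane) (N : ℕ) (ρ : ℝ) (x y : ℕ → ℝ) : Prop where
  x_mem : ∀ j, x j ∈ Icc (0 : ℝ) N
  y_mem : ∀ i, y i ∈ Icc (0 : ℝ) N
  x_zero : x 0 = 0
  y_zero : y 0 = 0
  y_last : y N = N
  x_mono : ∀ j < N, x j ≤ x (j + 1)
  y_mono : ∀ i < N, y i ≤ y (i + 1)
  le_or_le : ∀ i ≤ N, ∀ j ≤ N, (i : ℝ) ≤ x j ∨ (j : ℝ) ≤ y i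
  ge_or_ge : ∀ i ≤ N, ∀ j ≤ N, x j ≤ i ∨ y i ≤ j
  free_y : ∀ i ≤ N, ‖seqCurve P i - seqCurve Q (y i)‖ ≤ ρ
  free_x : ∀ j ≤ N, ‖seqCurve P (x j) - seqCurve Q j‖ ≤ ρ

/-- The heights are `σ i`, and each abscissa is some preimage of `j`; indices are cut off at `N` so
that all entries are defined. -/
theorem exists_isCrossing_of_isReparam (P Q : ℕ → Plane) {N : ℕ} {σ : ℝ → ℝ} {ρ : ℝ}
    (hσ : IsReparam N σ) (h : ∀ x ∈ Icc (0 : ℝ) N, ‖seqCurve P x - seqCurve Q (σ x)‖ ≤ ρ) :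
    ∃ x y, IsCrossing P Q N ρ x y := by
  obtain ⟨hc, hm, h0, hN⟩ := hσ
  have hN0 : (0 : ℝ) ≤ N := Nat.cast_nonneg N
  have hl := left_mem_Icc.2 hN0
  have hr := right_mem_Icc.2 hN0
  have hmem : ∀ i ≤ N, (i : ℝ) ∈ Icc (0 : ℝ) N := fun i hi => ⟨by positivity, by exact_mod_cast hi⟩
  have hmem' : ∀ i : ℕ, ((min i N : ℕ) : ℝ) ∈ Icc (0 : ℝ) N := fun i => hmem _ (min_le_right _ _)
  have hx : ∀ j : ℕ, ∃ x ∈ Icc (0 : ℝ) N, σ x = (min j N : ℕ) ∧ (j = 0 → x = 0) := by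
    intro j
    -- If `σ` stays at `0` for a while, `0` has many preimages; `0` itself is chosen, as `x_zero`
    -- demands.
    rcases Nat.eq_zero_or_pos j with rfl | hj
    · exact ⟨0, hl, by simp [h0], fun _ => rfl⟩
    · obtain ⟨x, hx, hxj⟩ := intermediate_value_Icc hN0 hc
        (show ((min j N : ℕ) : ℝ) ∈ Icc (σ 0) (σ N) by rw [h0, hN]; exact hmem' j)
      exact ⟨x, hx, hxj, by omega⟩
  choose x hxmem hxσ hx0 using hx
  have hxσ' : ∀ j ≤ N, σ (x j) = j := fun j hj => by rw [hxσ, min_eq_left hj]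
  have hσmem : ∀ t ∈ Icc (0 : ℝ) N, σ t ∈ Icc (0 : ℝ) N := fun t ht =>
    ⟨h0 ▸ hm hl ht ht.1, (hm ht hr ht.2).trans_eq hN⟩
  refine ⟨x, fun i => σ (min i N : ℕ), ?_⟩
  have hy : ∀ i ≤ N, σ (min i N : ℕ) = σ i := fun i hi => by rw [min_eq_left hi]
  constructor
  · exact hxmem
  · exact fun i => hσmem _ (hmem' i)
  · exact hx0 0 rfl
  · simp [h0]
  · simp [hN]
  · intro j hj
    by_contra! hlt
    have := hm (hxmem _) (hxmem _) hlt.le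
    rw [hxσ' _ hj.le, hxσ' _ (by omega)] at this
    have : j + 1 ≤ j := by exact_mod_cast this
    omega
  · intro i _
    exact hm (hmem' _) (hmem' _) (by exact_mod_cast min_le_min_right N (Nat.le_succ i))
  · intro i hi j hj
    rw [hy i hi]
    refine (le_or_gt (i : ℝ) (x j)).imp id fun hlt => ?_
    rw [← hxσ' j hj]
    exact hm (hxmem j) (hmem i hi) hlt.le
  · intro i hi j hj
    rw [hy i hi]
    refine (le_or_gt (x j) i).imp id fun hlt => ?_
    rw [← hxσ' j hj]
    exact hm (hmem i hi) (hxmem j) hlt.le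
  · intro i hi
    rw [hy i hi]
    exact h i (hmem i hi)
  · intro j hj
    rw [← hxσ' j hj]
    exact h _ (hxmem j)

/-- Reparametrizations need not converge as `ρ` tends to `1`, but crossings lie in a compact product
of intervals. All conditions on them, including the disjunctions of weak inequalities, are closed
and survive in the limit. -/
theorem exists_isCrossing_one (P Q : ℕ → Plane) {N : ℕ}
    (h : ∀ ρ : ℝ, 1 < ρ → ∃ x y, IsCrossing P Q N ρ x y) : ∃ x y, IsCrossing P Q N 1 x y := by
  choose x y hxy using fun k : ℕ => h (1 + 1 / ((k : ℝ) + 1)) (by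
    have : (0 : ℝ) < 1 / ((k : ℝ) + 1) := by positivity
    linarith)
  have hcomp : IsCompact (univ.pi (fun _ : ℕ => Icc (0 : ℝ) N) ×ˢ
      univ.pi (fun _ : ℕ => Icc (0 : ℝ) N)) :=
    (isCompact_univ_pi fun _ => isCompact_Icc).prod (isCompact_univ_pi fun _ => isCompact_Icc)
  obtain ⟨⟨x', y'⟩, hmem, φ, hφ, hlim⟩ := hcomp.tendsto_subseq (x := fun k => (x k, y k))
    fun k => ⟨fun j _ => (hxy k).x_mem j, fun i _ => (hxy k).y_mem i⟩
  rw [Prod.tendsto_iff] at hlim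
  have hx : ∀ j, Tendsto (fun k => x (φ k) j) atTop (𝓝 (x' j)) := tendsto_pi_nhds.1 hlim.1
  have hy : ∀ i, Tendsto (fun k => y (φ k) i) atTop (𝓝 (y' i)) := tendsto_pi_nhds.1 hlim.2
  have hx'mem : ∀ j, x' j ∈ Icc (0 : ℝ) N := fun j => hmem.1 j (mem_univ j)
  have hy'mem : ∀ i, y' i ∈ Icc (0 : ℝ) N := fun i => hmem.2 i (mem_univ i)
  have hρ : Tendsto (fun k => 1 + 1 / ((φ k : ℝ) + 1)) atTop (𝓝 1) := by
    simpa using (tendsto_one_div_add_atTop_nhds_zero_nat.comp hφ.tendsto_atTop).const_add (1 : ℝ)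
  have hcurve : ∀ (R : ℕ → Plane) (u : ℕ → ℝ) (v : ℝ), (∀ k, u k ∈ Icc (0 : ℝ) N) →
      v ∈ Icc (0 : ℝ) N → Tendsto u atTop (𝓝 v) →
      Tendsto (fun k => seqCurve R (u k)) atTop (𝓝 (seqCurve R v)) := fun R u v hu hv huv =>
    (continuousOn_seqCurve R N v hv).tendsto.comp
      (tendsto_nhdsWithin_iff.2 ⟨huv, .of_forall hu⟩)
  have hor : ∀ {a b : ℝ} {u v : ℕ → ℝ} {u' v' : ℝ}, Tendsto u atTop (𝓝 u') →
      Tendsto v atTop (𝓝 v') → (∀ k, a ≤ u k ∨ b ≤ v k) → a ≤ u' ∨ b ≤ v' := by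
    intro a b u v u' v' hu hv huv
    by_contra! hlt
    obtain ⟨k, hk, hk'⟩ := ((hu.eventually_lt_const hlt.1).and (hv.eventually_lt_const hlt.2)).exists
    rcases huv k with h | h <;> linarith
  refine ⟨x', y', hx'mem, hy'mem, ?_, ?_, ?_, ?_, ?_, ?_, ?_, ?_, ?_⟩
  · exact tendsto_nhds_unique (hx 0) (by simp [(hxy _).x_zero])
  · exact tendsto_nhds_unique (hy 0) (by simp [(hxy _).y_zero])
  · exact tendsto_nhds_unique (hy N) (by simp [(hxy _).y_last])
  · exact fun j hj => le_of_tendsto_of_tendsto' (hx j) (hx (j + 1)) fun k => (hxy _).x_mono j hj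
  · exact fun i hi => le_of_tendsto_of_tendsto' (hy i) (hy (i + 1)) fun k => (hxy _).y_mono i hi
  · exact fun i hi j hj => hor (hx j) (hy i) fun k => (hxy _).le_or_le i hi j hj
  · intro i hi j hj
    refine (hor (a := -i) (b := -j) (hx j).neg (hy i).neg fun k => ?_).imp neg_le_neg_iff.1
      neg_le_neg_iff.1
    exact ((hxy _).ge_or_ge i hi j hj).imp neg_le_neg neg_le_neg
  · exact fun i hi => le_of_tendsto_of_tendsto' (tendsto_const_nhds.sub
      (hcurve Q _ _ (fun k => (hxy _).y_mem i) (hy'mem i) (hy i))).norm hρ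
      fun k => (hxy _).free_y i hi
  · exact fun j hj => le_of_tendsto_of_tendsto' ((hcurve P _ _ (fun k => (hxy _).x_mem j)
      (hx'mem j) (hx j)).sub tendsto_const_nhds).norm hρ fun k => (hxy _).free_x j hj

/-- One step of the induction that shows that crossings are reachable. -/
theorem gridStep_crossing {α β : ℕ → ℕ → ℝ} {E E' : ℕ → ℕ → Bool → ℝ} {x y : ℕ → ℝ}
    (hα : ∀ i j, α (i + 1) j = gridStep (β i j) (α i j) (E i j false) (E i j true))
    (hβ : ∀ i j, β i (j + 1) = gridStep (α i j) (β i j) (E' i j false) (E' i j true))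
    (hE1 : ∀ i j, E i j true ≤ 1) {i j : ℕ} (hy0 : 0 ≤ y i)
    (hym : y i ≤ y (i + 1)) (h1 : (i : ℝ) ≤ x j ∨ (j : ℝ) ≤ y i)
    (h2 : x j ≤ (i + 1 : ℕ) ∨ y (i + 1) ≤ j)
    (hfree : (j : ℝ) ≤ y (i + 1) → y (i + 1) ≤ j + 1 →
      E i j false ≤ y (i + 1) - j ∧ y (i + 1) - j ≤ E i j true)
    (hfree' : ∀ k, j = k + 1 → y (i + 1) = j → E' i k false ≤ 1 ∧ 1 ≤ E' i k true)
    (iha : (j : ℝ) ≤ y i → y i ≤ j + 1 → α i j ≤ y i - j)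
    (ihb : (i : ℝ) ≤ x j → x j ≤ i + 1 → β i j ≤ x j - i)
    (iha' : ∀ k, j = k + 1 → (k : ℝ) ≤ y (i + 1) → y (i + 1) ≤ k + 1 →
      α (i + 1) k ≤ y (i + 1) - k)
    (hle : (j : ℝ) ≤ y (i + 1)) (hle' : y (i + 1) ≤ j + 1) : α (i + 1) j ≤ y (i + 1) - j := by
  obtain ⟨hl, hr⟩ := hfree hle hle'
  rw [hα]
  refine gridStep_le ?_ hl hr
  rcases le_or_gt (j : ℝ) (y i) with hji | hji
  · exact .inr ((iha hji (hym.trans hle')).trans (by linarith))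
  · left
    have hx := h1.resolve_right (not_le.2 hji)
    rcases le_or_gt (x j) (i + 1) with hx' | hx'
    · linarith [ihb hx hx']
    -- The path passes through the corner `(i + 1, j)`, and the chosen `x j` lies beyond it, so
    -- `ihb` does not apply. The cell below then has a reachable right side, hence a nonempty
    -- entrance, and its upper side is free at the corner; so `β i j ≤ 1`.
    · have hyj : y (i + 1) = j := le_antisymm (h2.resolve_left (by push_cast; linarith)) hle
      have hj0 : j ≠ 0 := by
        rintro rfl
        rw [Nat.cast_zero] at hji
        linarith
      obtain ⟨k, rfl⟩ := Nat.exists_eq_succ_of_ne_zero hj0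
      rw [Nat.succ_eq_add_one] at *
      have hk : y (i + 1) = k + 1 := by rw [hyj]; push_cast; rfl
      have hα1 : α (i + 1) k ≤ 1 := by
        have := iha' k rfl (by linarith) hk.le
        linarith
      rw [hα] at hα1
      obtain ⟨hl', hr'⟩ := hfree' k rfl hyj
      rw [hβ]
      refine gridStep_le ?_ hl' hr'
      rcases gridStep_le_one (hE1 i k) hα1 with h | h
      · exact .inr h.1
      · exact .inl h.1

/-- Completeness of the recursion, by induction on `i + j`: no crossing lies below the computed
start. The statement for lower sides comes from the same step with the two curves exchanged. -/
theorem gridStart_le_of_isCrossing {P Q : ℕ → Plane} {N : ℕ} {x y : ℕ → ℝ}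
    (h : IsCrossing P Q N 1 x y) (n : ℕ) : ∀ i j, i + j = n → i ≤ N → j ≤ N →
      ((j : ℝ) ≤ y i → y i ≤ j + 1 → leftStart P Q i j ≤ y i - j) ∧
      ((i : ℝ) ≤ x j → x j ≤ i + 1 → lowerStart P Q i j ≤ x j - i) := by
  have base : offsetSq (P 0) (Q 0) ≤ 0 := by
    have := h.free_y 0 (Nat.zero_le _)
    rwa [h.y_zero, seqCurve_natCast, ← Nat.cast_zero (R := ℝ), seqCurve_natCast,
      norm_sub_le_one_iff] at this
  induction n using Nat.strong_induction_on with
  | _ n ih =>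
  intro i j hij hi hj
  constructor
  · intro h1 h2
    cases i with
    | zero =>
      rw [h.y_zero] at h1 h2 ⊢
      have hj0 : j = 0 := by exact_mod_cast le_antisymm h1 (Nat.cast_nonneg j)
      subst hj0
      simp [leftStart_zero_zero, base]
    | succ i =>
      refine gridStep_crossing (x := x) (y := y) (leftStart_succ P Q)
        (E := fun i j => freeEnd (P (i + 1)) (Q j) (Q (j + 1)))
        (E' := fun i j => freeEnd (Q (j + 1)) (P i) (P (i + 1)))
        (lowerStart_succ P Q) (fun _ _ => freeEnd_true_le_one _ _ _) (h.y_mem i).1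
        (h.y_mono i hi) (h.le_or_le i (by omega) j hj) (h.ge_or_ge (i + 1) hi j hj) ?_ ?_
        (ih (i + j) (by omega) i j rfl (by omega) hj).1
        (ih (i + j) (by omega) i j rfl (by omega) hj).2 ?_ h1 h2
      · intro h3 h4
        rw [← isFree_left_iff (i + 1) j (by linarith) (by linarith), IsFree, add_sub_cancel]
        exact h.free_y (i + 1) hi
      · rintro k rfl hk
        rw [← isFree_lower_iff i (k + 1) zero_le_one le_rfl, IsFree]
        have := h.free_y (i + 1) hi
        rw [hk] at this
        exact_mod_cast this
      · rintro k rfl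
        exact (ih (i + 1 + k) (by omega) (i + 1) k rfl hi (by omega)).1
  · intro h1 h2
    cases j with
    | zero =>
      rw [h.x_zero] at h1 h2 ⊢
      have hi0 : i = 0 := by exact_mod_cast le_antisymm h1 (Nat.cast_nonneg i)
      subst hi0
      simp [lowerStart_zero_zero, base]
    | succ j =>
      refine gridStep_crossing (x := y) (y := x) (α := fun j i => lowerStart P Q i j)
        (β := fun j i => leftStart P Q i j)
        (E := fun j i => freeEnd (Q (j + 1)) (P i) (P (i + 1)))
        (E' := fun j i => freeEnd (P (i + 1)) (Q j) (Q (j + 1)))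
        (fun j i => lowerStart_succ P Q i j) (fun j i => leftStart_succ P Q i j)
        (fun _ _ => freeEnd_true_le_one _ _ _) (h.x_mem j).1
        (h.x_mono j hj) (h.le_or_le i hi j (by omega)).symm (h.ge_or_ge i hi (j + 1) hj).symm ?_ ?_
        (ih (i + j) (by omega) i j rfl hi (by omega)).2
        (ih (i + j) (by omega) i j rfl hi (by omega)).1 ?_ h1 h2
      · intro h3 h4
        rw [← isFree_lower_iff i (j + 1) (by linarith) (by linarith), IsFree, add_sub_cancel]
        exact h.free_x (j + 1) hj
      · rintro k rfl hk
        rw [← isFree_left_iff (k + 1) j zero_le_one le_rfl, IsFree]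
        have := h.free_x (j + 1) hj
        rw [hk] at this
        exact_mod_cast this
      · rintro k rfl
        exact (ih (k + (j + 1)) (by omega) k (j + 1) rfl (by omega) hj).2

/-- Continued with slope one past `n`, where the padded curves no longer move. -/
theorem IsReparam.extend {n N : ℕ} (hnN : n ≤ N) {σ : ℝ → ℝ} (hσ : IsReparam n σ) :
    IsReparam N fun x => σ (min x n) + (max x n - n) := by
  obtain ⟨hc, hm, h0, hn⟩ := hσ
  have hn0 : (0 : ℝ) ≤ n := Nat.cast_nonneg n
  have hmaps : MapsTo (fun x : ℝ => min x n) (Icc (0 : ℝ) N) (Icc (0 : ℝ) n) := fun x hx =>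
    ⟨le_min hx.1 hn0, min_le_right _ _⟩
  refine ⟨?_, ?_, by simp [h0], ?_⟩
  · exact (hc.comp (by fun_prop) hmaps).add (by fun_prop)
  · intro s hs t ht hst
    exact add_le_add (hm (hmaps hs) (hmaps ht) (min_le_min_right _ hst))
      (sub_le_sub_right (max_le_max_right _ hst) _)
  · have : (n : ℝ) ≤ N := by exact_mod_cast hnN
    simp [this, hn]

/-- The Fréchet distance is at most one if and only if the upper right corner of the free space
diagram is free and reachable. -/
theorem frechetDist_le_one_iff {n N : ℕ} (hnN : n ≤ N + 1) (p q : Fin (n + 1) → Plane) :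
    frechetDist p q ≤ 1 ↔ leftStart (clampSeq p) (clampSeq q) (N + 1) N ≤ 1 ∧
      offsetSq (p (Fin.last n)) (q (Fin.last n)) ≤ 0 := by
  have hnN' : (n : ℝ) ≤ (N + 1 : ℕ) := by exact_mod_cast hnN
  have hlast : ∀ p : Fin (n + 1) → Plane,
      seqCurve (clampSeq p) ((N + 1 : ℕ) : ℝ) = p (Fin.last n) := fun p =>
    seqCurve_clampSeq_of_le p hnN'
  constructor
  · intro h
    obtain ⟨x, y, hxy⟩ := exists_isCrossing_one (clampSeq p) (clampSeq q) (N := N + 1) fun ρ hρ => by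
      obtain ⟨σ, hσ, hle⟩ := exists_isReparam_of_frechetDist_lt p q (h.trans_lt hρ)
      refine exists_isCrossing_of_isReparam _ _ (hσ.extend hnN) fun x hx => ?_
      rcases le_total x n with hxn | hxn
      · simpa [hxn, polyCurve_eq_seqCurve] using hle x ⟨hx.1, hxn⟩
      · have := hle n ⟨Nat.cast_nonneg n, le_rfl⟩
        rw [hσ.2.2.2] at this
        rw [polyCurve_eq_seqCurve, polyCurve_eq_seqCurve, seqCurve_clampSeq_of_le p le_rfl,
          seqCurve_clampSeq_of_le q le_rfl] at this
        rw [seqCurve_clampSeq_of_le p hxn, seqCurve_clampSeq_of_le]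
        · exact this
        · simp [hxn, hσ.2.2.2]
    constructor
    -- The right side of the last cell is the left side of the cell `(N + 1, N)`, and the path meets
    -- it at its top, at relative height `1`.
    · have := (gridStart_le_of_isCrossing hxy _ (N + 1) N rfl le_rfl (by omega)).1
      rw [hxy.y_last] at this
      push_cast at this
      linarith [this (by linarith) le_rfl]
    · have := hxy.free_y (N + 1) le_rfl
      rwa [hxy.y_last, hlast, hlast, norm_sub_le_one_iff] at this
  · rintro ⟨h1, h2⟩
    obtain ⟨h0, hconn, hfree⟩ := (monoConn_gridStart (P := clampSeq p) (Q := clampSeq q) _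
      (N + 1) N rfl).1 h1
    refine frechetDist_le_one_of_monoConn hnN (by omega) p q (hconn.trans ?_)
    have hend : IsFree (clampSeq p) (clampSeq q) ((N + 1 : ℕ) : ℝ) (N + 1 : ℕ) := by
      rwa [IsFree, hlast, hlast, norm_sub_le_one_iff]
    have := MonoConn.of_cell (P := clampSeq p) (Q := clampSeq q) (N + 1) N le_rfl le_rfl zero_le_one
      h0 h1 le_rfl (by simpa using hfree) (by simpa using hend)
    simpa using this

/-! ### Assembling the decision tree -/

namespace KState

theorem exists_can_sign_offsetSq : ∃ c : ℕ, ∀ (X : Type) (s : KState X) (p q : Fin 2 → X → ℝ),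
    Known 1 s → (∀ i, Known (p i) s) → (∀ i, Known (q i) s) →
      Can s c (SignKnown fun x => offsetSq (fun i => p i x) fun i => q i x) := by
  obtain ⟨c, hc⟩ := (SignDet.isPolyFun_offsetSq 0).exists_can
  refine ⟨c + 2, fun X s p q h1 hp hq => Can.sign ?_⟩
  have := hc X s (Sum.elim (fun k => p k.2) fun k => q k.2) h1 (by
    rintro (i | i)
    · exact hp _
    · exact hq _)
  simpa using this

/-- The constant one is available after a search for an input that is not zero, unless there is no
such input. -/
theorem can_one_or_zero {V : Type} (F : Finset V) (s : KState (V → ℝ))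
    (hs : ∀ v, Known (fun x => x v) s) :
    Can s (F.card * 2) fun t => (∀ v ∈ F, ∀ x ∈ t.dom, x v = 0) ∨ Known 1 t := by
  classical
  induction F using Finset.induction_on with
  | empty => exact fun t _ => .done (by simp)
  | insert v F hv ih =>
    rw [Finset.card_insert_of_notMem hv, add_mul, one_mul]
    refine ih.bind fun t hst ht u htu => ?_
    have hvu := monotone_known _ (hst.trans htu) (hs v)
    rcases ht with ht | ht
    · refine .eqZero hvu (.done (.inl fun w hw x hx => ?_)) ((OneOp.div
        (monotone_known _ (le_inter _ _) hvu) (monotone_known _ (le_inter _ _) hvu)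
        fun x hx => hx.2).reach.bind (e := 0) fun y hy hk => .done (.inr (hk.congr fun x hx => ?_)))
      · rcases Finset.mem_insert.1 hw with rfl | hw
        · exact hx.2
        · exact ht w hw x (htu.2 hx.1)
      · exact (div_self (hy.2 hx).2).symm
    · exact .done (.inr (monotone_known _ htu ht))

end KState

open KState

/-- The vertices of the two curves that are encoded by an input vector. -/
noncomputable def inputVertices {n : ℕ} (f : Fin (n + 1) → Fin (n + 1) ⊕ Fin (n + 1))
    (x : CurveVar n → ℝ) (i : Fin (n + 1)) : Plane :=
  WithLp.toLp 2 fun c => x (f i, c)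

/-- A decision tree for given block size `2 ^ k`. -/
theorem exists_tree_of_block_size : ∃ C e : ℕ, ∀ n k : ℕ, ∃ T : AlgTree (CurveVar n) 0,
    T.depth ≤ C * (n + 1 + (n / 2 ^ k + 1) * (2 ^ k) ^ e +
      (n / 2 ^ k + 1) * (n / 2 ^ k + 1) * 2 ^ k * (k + 1)) ∧
    ∀ p q : Fin (n + 1) → Plane, ∃ b : Bool, T.run (curveInput p q) = some b ∧
      (b = true ↔ frechetDist p q ≤ 1) := by
  classical
  obtain ⟨C, e, hgrid⟩ := KState.exists_can_grid
  obtain ⟨c, hoff⟩ := KState.exists_can_sign_offsetSq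
  refine ⟨8 + (2 + 2 * c) + C, e, fun n k => ?_⟩
  -- With `m` blocks per side the grid has `N + 1 ≥ n` cells per side; the curves are padded with
  -- their last vertices.
  set m := n / 2 ^ k + 1 with hm
  obtain ⟨N, hN⟩ : ∃ N, m * 2 ^ k = N + 1 :=
    Nat.exists_eq_succ_of_ne_zero (Nat.mul_pos (Nat.succ_pos _) (by positivity)).ne'
  have hnN : n ≤ N + 1 := by
    rw [← hN, hm, mul_comm]
    exact (Nat.lt_mul_div_succ n (by positivity)).le
  set p : (CurveVar n → ℝ) → Fin (n + 1) → Plane := inputVertices Sum.inl with hp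
  set q : (CurveVar n → ℝ) → Fin (n + 1) → Plane := inputVertices Sum.inr with hq
  set ans : (CurveVar n → ℝ) → Bool := fun x => decide (frechetDist (p x) (q x) ≤ 1) with hans
  set s : KState (CurveVar n → ℝ) := ⟨range fun v x => x v, univ⟩ with hs
  have hinput : ∀ v, Known (fun x : CurveVar n → ℝ => x v) s := fun v =>
    ⟨_, ⟨v, rfl⟩, fun _ _ => rfl⟩
  set P : ℕ → Fin 2 → (CurveVar n → ℝ) → ℝ := fun i c x => clampSeq (p x) i c with hP
  set Q : ℕ → Fin 2 → (CurveVar n → ℝ) → ℝ := fun i c x => clampSeq (q x) i c with hQ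
  have hPk : ∀ i c, Known (P i c) s := fun i c => hinput _
  have hQk : ∀ i c, Known (Q i c) s := fun i c => hinput _
  set α : ℕ → ℕ → (CurveVar n → ℝ) → ℝ := fun a b x =>
    leftStart (clampSeq (p x)) (clampSeq (q x)) a b with hα
  set β : ℕ → ℕ → (CurveVar n → ℝ) → ℝ := fun a b x =>
    lowerStart (clampSeq (p x)) (clampSeq (q x)) a b with hβ
  have hlast : ∀ p : Fin (n + 1) → Plane, clampSeq p n = p (Fin.last n) := fun p => by
    simp [clampSeq, Fin.last]
  have main : Reach (fun t => ∃ b, ∀ x ∈ t.dom, ans x = b) (4 * (n + 1) * 2 +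
      (2 + c + (C * (m * (2 ^ k) ^ e + m * m * 2 ^ k * (k + 1)) + c))) s := by
    have h1 := can_one_or_zero Finset.univ s hinput
    have hcard : (Finset.univ : Finset (CurveVar n)).card = 4 * (n + 1) := by
      simp
      ring
    rw [hcard] at h1
    refine (h1 s le_rfl).bind fun t hst ht => ?_
    -- If all inputs vanish, only one input reaches this node and its answer labels the leaf.
    -- Otherwise `1` has been obtained as a quotient `x / x`.
    rcases ht with ht | ht
    · refine .done ⟨ans 0, fun x hx => congrArg ans (funext fun v => ht v (Finset.mem_univ v) x hx)⟩
    have hPt : ∀ i c, Known (P i c) t := fun i c => monotone_known _ hst (hPk i c)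
    have hQt : ∀ i c, Known (Q i c) t := fun i c => monotone_known _ hst (hQk i c)
    have htwo : Can t 1 (Known fun _ => 2) :=
      ((can_of_known ht 0).add (can_of_known ht 0)).congr_known fun x _ => by norm_num
    have hinit := ((can_zero ht).and (monotone_known _) htwo).and
      (fun _ _ h hu => ⟨monotone_known _ h hu.1, monotone_known _ h hu.2⟩)
      (hoff _ t (P 0) (Q 0) ht (hPt 0) (hQt 0))
    refine (hinit t le_rfl).bind fun u htu hu => ?_
    obtain ⟨⟨k0, k2⟩, hsign⟩ := hu
    have hu1 := monotone_known _ htu ht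
    have k2' : KnownStatus (fun _ => 2) u := ⟨k2, .inl fun _ _ => rfl⟩
    have start : ∀ f : (CurveVar n → ℝ) → ℝ, (∀ x, f x = if offsetSq (clampSeq (p x) 0)
        (clampSeq (q x) 0) ≤ 0 then 0 else 2) → KnownStatus f u := by
      intro f hf
      rcases hsign.cases with h | h | h
      · have h0 : ∀ x ∈ u.dom, f x = 0 := fun x hx => by rw [hf, if_pos (h x hx).le]
        exact ⟨k0.congr h0, .inr fun x hx => (h0 x hx).trans_le zero_le_one⟩
      · have h0 : ∀ x ∈ u.dom, f x = 0 := fun x hx => by rw [hf, if_pos (h x hx).le]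
        exact ⟨k0.congr h0, .inr fun x hx => (h0 x hx).trans_le zero_le_one⟩
      · have h2 : ∀ x ∈ u.dom, f x = 2 := fun x hx => by rw [hf, if_neg (not_le.2 (h x hx))]
        exact ⟨k2.congr h2, .inl h2⟩
    have hα0 : ∀ b, KnownStatus (α 0 b) u := by
      rintro (_ | b)
      · exact start _ fun x => leftStart_zero_zero _ _
      · simpa only [hα, leftStart_zero_succ] using k2'
    have hβ0 : ∀ a, KnownStatus (β a 0) u := by
      rintro (_ | a)
      · exact start _ fun x => lowerStart_zero_zero _ _
      · simpa only [hβ, lowerStart_succ_zero] using k2'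
    have hg := hgrid _ u P Q α β k m (fun a b x => leftStart_succ _ _ a b)
      (fun a b x => lowerStart_succ _ _ a b) hu1 (fun a i => monotone_known _ htu (hPt a i))
      (fun b i => monotone_known _ htu (hQt b i)) hα0 hβ0
    refine (hg u le_rfl).bind fun v huv hv => ?_
    have hend := hv N (by omega)
    rw [hN] at hend
    refine (hoff _ v (P n) (Q n) (monotone_known _ huv hu1)
      (fun i => monotone_known _ (htu.trans huv) (hPt n i))
      (fun i => monotone_known _ (htu.trans huv) (hQt n i)) v le_rfl).bind (e := 0)
        fun w hvw hw => .done ?_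
    have hans' : ∀ x, ans x = decide (α (N + 1) N x ≤ 1 ∧
        offsetSq (fun i => P n i x) (fun i => Q n i x) ≤ 0) := fun x => by
      simp only [hans, frechetDist_le_one_iff hnN, hα, hP, hQ, hlast]
    rcases hend.2 with h | h
    · refine ⟨false, fun x hx => ?_⟩
      rw [hans', h x (hvw.2 hx)]
      norm_num
    · rcases hw.cases with h' | h' | h'
      · exact ⟨true, fun x hx => by rw [hans']; simp [h x (hvw.2 hx), (h' x hx).le]⟩
      · exact ⟨true, fun x hx => by rw [hans']; simp [h x (hvw.2 hx), (h' x hx).le]⟩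
      · exact ⟨false, fun x hx => by rw [hans']; simp [h' x hx]⟩
  obtain ⟨T, hT, hrun⟩ := main.exists_tree (fun _ => Fin.elim0) (by
    rintro _ ⟨v, rfl⟩
    exact ⟨.inl v, fun _ _ => rfl⟩)
  refine ⟨T, hT.trans ?_, fun p' q' => ⟨_, hrun _ (mem_univ _), ?_⟩⟩
  · generalize m * (2 ^ k) ^ e = A
    generalize m * m * 2 ^ k * (k + 1) = B
    have := Nat.zero_le ((8 + (2 + 2 * c)) * (A + B))
    have := Nat.zero_le ((2 + 2 * c + C) * n)
    nlinarith
  · have hp' : p (curveInput p' q') = p' := by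
      ext i c
      rfl
    have hq' : q (curveInput p' q') = q' := by
      ext i c
      rfl
    simp [hans, hp', hq']

/-! ### Choice of the block size -/

/-- Used to absorb the logarithmic factor into a square root of the block size. -/
theorem natCast_le_four_mul_two_rpow (k : ℕ) : (k : ℝ) ≤ 4 * (2 : ℝ) ^ ((k : ℝ) / 2) := by
  have h1 := Real.add_one_le_exp (Real.log 2 * ((k : ℝ) / 2))
  rw [Real.rpow_def_of_pos (by norm_num)]
  have h2 := Real.log_two_gt_d9
  have h3 : (0 : ℝ) ≤ k := Nat.cast_nonneg k
  nlinarith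

/-- The depth bound for a suitable block size. -/
theorem block_cost_le (e n : ℕ) (hn : 1 ≤ n) :
    ((n + 1 + (n / 2 ^ (Nat.log 2 n / (e + 2)) + 1) * (2 ^ (Nat.log 2 n / (e + 2))) ^ e +
      (n / 2 ^ (Nat.log 2 n / (e + 2)) + 1) * (n / 2 ^ (Nat.log 2 n / (e + 2)) + 1) *
        2 ^ (Nat.log 2 n / (e + 2)) * (Nat.log 2 n / (e + 2) + 1) : ℕ) : ℝ) ≤
      40 * (n : ℝ) ^ (2 - 1 / (2 * ((e : ℝ) + 2))) := by
  set k := Nat.log 2 n / (e + 2) with hk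
  have hn' : (1 : ℝ) ≤ n := by exact_mod_cast hn
  have hn0 : (0 : ℝ) < n := by linarith
  set τ : ℝ := 2 ^ k with hτ
  have hτ1 : 1 ≤ τ := one_le_pow₀ (by norm_num)
  have hτM : τ ^ (e + 2) ≤ n := by
    have h1 : (2 ^ k) ^ (e + 2) ≤ n := by
      rw [← pow_mul]
      exact (Nat.pow_le_pow_right (by norm_num) (Nat.div_mul_le_self _ _)).trans
        (Nat.pow_log_le_self 2 (by omega))
    rw [hτ]
    exact_mod_cast h1
  have hnk : (n : ℝ) ≤ 2 ^ ((k + 1) * (e + 2)) := by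
    have h1 : n < 2 ^ (Nat.log 2 n + 1) := Nat.lt_pow_succ_log_self (by norm_num) n
    have h2 : Nat.log 2 n + 1 ≤ (k + 1) * (e + 2) := by
      have := Nat.lt_mul_div_succ (Nat.log 2 n) (show 0 < e + 2 by omega)
      rw [← hk, mul_comm] at this
      omega
    exact_mod_cast (h1.trans_le (Nat.pow_le_pow_right (by norm_num) h2)).le
  have hτn : τ ≤ n := (le_self_pow₀ hτ1 (by omega)).trans hτM
  have hm : (((n / 2 ^ k + 1 : ℕ) : ℝ)) ≤ 2 * n / τ := by
    have h1 : ((n / 2 ^ k : ℕ) : ℝ) ≤ n / τ := by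
      have := Nat.cast_div_le (α := ℝ) (m := n) (n := 2 ^ k)
      rwa [Nat.cast_pow, Nat.cast_ofNat] at this
    have h2 : 1 ≤ (n : ℝ) / τ := (one_le_div (by linarith)).2 hτn
    push_cast
    rw [mul_div_assoc]
    linarith
  set m : ℝ := ((n / 2 ^ k + 1 : ℕ) : ℝ) with hmdef
  have hm0 : 0 ≤ m := Nat.cast_nonneg _
  -- `u = √(2τ)` is the factor that is saved: the main term has order `n² k / τ`, the factor `k + 1`
  -- is at most `4u`, and `u ≥ n ^ (1 / (2 (e + 2)))`.
  set u : ℝ := (2 : ℝ) ^ (((k + 1 : ℕ) : ℝ) / 2) with hu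
  have hu0 : 0 < u := by positivity
  have hu2 : u * u = 2 * τ := by
    rw [hu, ← Real.rpow_add (by norm_num), add_halves, Real.rpow_natCast, pow_succ]
    ring
  have hku : ((k + 1 : ℕ) : ℝ) ≤ 4 * u := natCast_le_four_mul_two_rpow (k + 1)
  have hne : (n : ℝ) ^ (1 / (2 * ((e : ℝ) + 2))) ≤ u := by
    calc (n : ℝ) ^ (1 / (2 * ((e : ℝ) + 2)))
        ≤ ((2 : ℝ) ^ ((k + 1) * (e + 2))) ^ (1 / (2 * ((e : ℝ) + 2))) :=
          Real.rpow_le_rpow hn0.le hnk (by positivity)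
      _ = u := by
        rw [← Real.rpow_natCast, ← Real.rpow_mul (by norm_num), hu]
        congr 1
        push_cast
        field_simp
  have hmain : (n : ℝ) ^ 2 / u ≤ (n : ℝ) ^ (2 - 1 / (2 * ((e : ℝ) + 2))) := by
    rw [Real.rpow_sub hn0, Real.rpow_two]
    exact div_le_div_of_nonneg_left (by positivity) (by positivity) hne
  have hu1 : 1 ≤ u := Real.one_le_rpow (by norm_num) (by positivity)
  have hτu : (1 : ℝ) / τ ≤ 2 / u := by
    rw [div_le_div_iff₀ (by linarith) hu0]
    nlinarith
  have hn2τ : (n : ℝ) ^ 2 / τ ≤ 2 * ((n : ℝ) ^ 2 / u) := by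
    have := mul_le_mul_of_nonneg_left hτu (sq_nonneg (n : ℝ))
    calc (n : ℝ) ^ 2 / τ = (n : ℝ) ^ 2 * (1 / τ) := by ring
      _ ≤ (n : ℝ) ^ 2 * (2 / u) := this
      _ = 2 * ((n : ℝ) ^ 2 / u) := by ring
  have e1 : (n : ℝ) + 1 ≤ 2 * ((n : ℝ) ^ 2 / τ) := by
    have : (n : ℝ) ≤ (n : ℝ) ^ 2 / τ := by
      rw [le_div_iff₀ (by linarith)]
      nlinarith
    linarith
  have e2 : m * τ ^ e ≤ 2 * ((n : ℝ) ^ 2 / τ) := by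
    have h1 : τ ^ e ≤ n := (pow_le_pow_right₀ hτ1 (by omega)).trans hτM
    calc m * τ ^ e ≤ 2 * n / τ * n := mul_le_mul hm h1 (by positivity) (by positivity)
      _ = 2 * ((n : ℝ) ^ 2 / τ) := by ring
  have e3 : m * m * τ * ((k + 1 : ℕ) : ℝ) ≤ 32 * ((n : ℝ) ^ 2 / u) := by
    have h1 : m * m * τ ≤ 4 * ((n : ℝ) ^ 2 / τ) := by
      calc m * m * τ ≤ (2 * n / τ) * (2 * n / τ) * τ :=
            mul_le_mul_of_nonneg_right (mul_le_mul hm hm hm0 (by positivity)) (by linarith)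
        _ = 4 * ((n : ℝ) ^ 2 / τ) := by
          field_simp
          ring
    calc m * m * τ * ((k + 1 : ℕ) : ℝ) ≤ 4 * ((n : ℝ) ^ 2 / τ) * (4 * u) :=
          mul_le_mul h1 hku (by positivity) (by positivity)
      _ = 32 * ((n : ℝ) ^ 2 / u) := by
        have : τ = u * u / 2 := by linarith
        rw [this]
        field_simp
        ring
  have hcast : ((n + 1 + (n / 2 ^ k + 1) * (2 ^ k) ^ e +
      (n / 2 ^ k + 1) * (n / 2 ^ k + 1) * 2 ^ k * (k + 1) : ℕ) : ℝ) =
      n + 1 + m * τ ^ e + m * m * τ * ((k + 1 : ℕ) : ℝ) := by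
    rw [hmdef, hτ]
    push_cast
    ring
  rw [hcast]
  linarith

theorem mainTheorem2 :
    ∃ ε : ℝ, 0 < ε ∧ ∃ T : (n : ℕ) → AlgTree (CurveVar n) 0,
      ((fun n : ℕ => ((T n).depth : ℝ)) =O[atTop] fun n : ℕ => (n : ℝ) ^ (2 - ε)) ∧
      ∀ (n : ℕ) (p q : Fin (n + 1) → Plane),
        ∃ b : Bool, (T n).run (curveInput p q) = some b ∧
          (b = true ↔ frechetDist p q ≤ 1) := by
  obtain ⟨C, e, h⟩ := exists_tree_of_block_size
  -- The block size `τ` is about `n ^ (1 / (e + 2))`, so that `τ ^ (e + 2) ≤ n` and preprocessing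
  -- stays below `n² / τ` up to a constant.
  choose T hT hrun using fun n => h n (Nat.log 2 n / (e + 2))
  refine ⟨1 / (2 * ((e : ℝ) + 2)), by positivity, T, ?_, hrun⟩
  refine IsBigO.of_bound ((C : ℝ) * 40) ((eventually_ge_atTop 1).mono fun n hn => ?_)
  rw [Real.norm_of_nonneg (Nat.cast_nonneg _), Real.norm_of_nonneg (by positivity), mul_assoc]
  refine le_trans ?_ (mul_le_mul_of_nonneg_left (block_cost_le e n hn) (Nat.cast_nonneg C))
  rw [← Nat.cast_mul]
  exact Nat.cast_le.2 (hT n)
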